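/- **Conventions.** Let $n,k\ge 0$. A permutation of $[n]=\{1,\dots,n\}$ is written as a word $\sigma=\sigma_1\cdots\sigma_n$, with the convention $\sigma_0=\sigma_{n+1}=0$. The letter $\sigma_i$ ($1\le i\le n$) is a peak if $\sigma_{i-1}<\sigma_i>\sigma_{i+1}$, a valley if $\sigma_{i-1}>\sigma_i<\sigma_{i+1}$, a double ascent if $\sigma_{i-1}<\sigma_i<\sigma_{i+1}$, and a double descent if $\sigma_{i-1}>\sigma_i>\sigma_{i+1}$. Let $\mathrm{Val}\,\sigma$ be the set of valleys of $\sigma$ (as letters), and let $\mathrm{des}\,\sigma$ be the number of $1\le i<n$ with $\sigma_i>\sigma_{i+1}$. Put $$\mathrm{les}\,\sigma=\#\{(i,j): 2\le i<j\le n,\ \sigma_{i-1}>\sigma_j>\sigma_i\},\qquad \mathrm{res}\,\sigma=\#\{(i,j): 1\le i<j\le n-1,\ \sigma_{j+1}>\sigma_i>\sigma_j\}.$$ Let $\mathcal G_{n,k}$ be the set of permutations of $[n]$ with exactly $k$ valleys and no double descents. A permutation $\sigma$ of $[n]$ is an André permutation if for every $1\le m\le n$ the subword of $\sigma$ formed by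 the letters $1,\dots,m$ has no double descents (the same convention being applied to the subword). Let $\mathfrak D_{n,k}$ be the set of André permutations of $[n]$ with $\mathrm{des}\,\sigma=k$; such a $\sigma$ has exactly $k$ valleys. **The transform at one valley.** For a letter $x$ of $\sigma$ write $\sigma=w_1w_2\,x\,w_4w_5$, where $w_2$ and $w_4$ are the longest (possibly empty) factors immediately to the left and to the right of $x$ all of whose letters exceed $x$. Let $\sigma$ have no double descents and let $x$ be a valley of $\sigma$ (so that $w_2,w_4$ are nonempty). Put $y_1=\min w_2$, $y_2=\min w_4$, $y=\min(y_1,y_2)$. The valley $x$ is of type I if $y$ is a peak or a double ascent of $\sigma$, and of type II if $y$ is a valley of $\sigma$. Define $\varphi(\sigma,x)$ as follows. * If $y$ is a peak: $\varphi(\sigma,x)=w_1\,y\,x\,w_2\,w_5$ if $y=y_2$, and $w_1\,w_4\,x\,y\,w_5$ if $y=y_1$. * If $y$ is a double ascent: $\varphi(\sigma,x)=w_1\,y\,w_2\,x\,w''\,w_5$ if $y=y_2$ and $w_4=yw''$, and $w_1\,w''\,x\,y\,w_4\,w_5$ if $y=y_1$ and $w_2=yw''$. * If $y$ is a valley: $\varphi(\sigma,x)=w_1\,w_2\,y\,w'\,x\,w''\,w_5$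 if $y=y_2$ and $w_4=w'yw''$, and $w_1\,w'\,x\,w''\,y\,w_4\,w_5$ if $y=y_1$ and $w_2=w'yw''$. **The map.** For $\sigma\in\mathfrak D_{n,k}$ and $S\subseteq\mathrm{Val}\,\sigma$ let $S_1$ and $S_2$ be the sets of those $x\in S$ that are of type I, respectively of type II, in $\sigma$. The word $\varphi(\sigma,S)$ is obtained from $\sigma$ by applying successively the transforms $\varphi(\cdot,x)$, first for the $x\in S_1$ (in any order), then for the $x\in S_2$ in decreasing order. If $\mathrm{Val}\,\sigma=\{a_1<\dots<a_k\}$, a subset $S\in 2^{[k]}$ of $[k]$ is identified with the subset $\{a_i: i\in S\}$ of $\mathrm{Val}\,\sigma$. **Proposition.** For all $n,k\ge 0$, the word $\varphi(\sigma,S)$ does not depend on the order chosen on $S_1$, for $\sigma\in\mathfrak D_{n,k}$ and $S\subseteq\mathrm{Val}\,\sigma$, and the map $$\varphi:\mathfrak D_{n,k}\times 2^{[k]}\to\mathcal G_{n,k},\qquad (\sigma,S)\mapsto\varphi(\sigma,S),$$ is a bijection. Moreover, for all $(\sigma,S)\in\mathfrak D_{n,k}\times 2^{[k]}$, $$\mathrm{res}\,\varphi(\sigma,S)=\mathrm{res}\,\sigma+|S|,\qquad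 \mathrm{les}\,\varphi(\sigma,S)=\mathrm{les}\,\sigma-|S|.$$ -/

import Mathlib

namespace AndrePerm

/-- A permutation of `[n] = {1, …, n}`, written as a word `σ₁ ⋯ σₙ`. -/
def IsPermutation (n : ℕ) (σ : List ℕ) : Prop :=
  σ.Perm (List.range' 1 n)

/-- The entry `σᵢ` with the positions counted from `1`, and `σ₀ = σₙ₊₁ = 0`. -/
def entry (σ : List ℕ) (i : ℕ) : ℕ :=
  (0 :: σ).getD i 0

/-- The set of (the values of) the peaks of `σ`. -/
def peaks (σ : List ℕ) : Finset ℕ :=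
  ((Finset.Icc 1 σ.length).filter fun i =>
    entry σ (i - 1) < entry σ i ∧ entry σ i > entry σ (i + 1)).image (entry σ)

/-- The set `Val σ` of (the values of) the valleys of `σ`. -/
def valleys (σ : List ℕ) : Finset ℕ :=
  ((Finset.Icc 1 σ.length).filter fun i =>
    entry σ (i - 1) > entry σ i ∧ entry σ i < entry σ (i + 1)).image (entry σ)

/-- The set of (the values of) the double ascents of `σ`. -/
def doubleAscents (σ : List ℕ) : Finset ℕ :=
  ((Finset.Icc 1 σ.length).filter fun i =>
    entry σ (i - 1) < entry σ i ∧ entry σ i < entry σ (i + 1)).image (entry σ)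

/-- The set of (the values of) the double descents of `σ`. -/
def doubleDescents (σ : List ℕ) : Finset ℕ :=
  ((Finset.Icc 1 σ.length).filter fun i =>
    entry σ (i - 1) > entry σ i ∧ entry σ i > entry σ (i + 1)).image (entry σ)

/-- The number of descent positions, i.e. of `1 ≤ i < n` with `σᵢ > σᵢ₊₁`. -/
def des (σ : List ℕ) : ℕ :=
  ((Finset.Ico 1 σ.length).filter fun i => entry σ i > entry σ (i + 1)).card

/-- The number of pairs `(i, j)` with `2 ≤ i < j ≤ n` and `σᵢ₋₁ > σⱼ > σᵢ`. -/
def les (σ : List ℕ) : ℕ :=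
  ((Finset.Icc 1 σ.length ×ˢ Finset.Icc 1 σ.length).filter fun p =>
    2 ≤ p.1 ∧ p.1 < p.2 ∧ entry σ (p.1 - 1) > entry σ p.2 ∧ entry σ p.2 > entry σ p.1).card

/-- The number of pairs `(i, j)` with `1 ≤ i < j ≤ n - 1` and `σⱼ₊₁ > σᵢ > σⱼ`. -/
def res (σ : List ℕ) : ℕ :=
  ((Finset.Icc 1 σ.length ×ˢ Finset.Icc 1 σ.length).filter fun p =>
    p.1 < p.2 ∧ p.2 + 1 ≤ σ.length ∧
      entry σ (p.2 + 1) > entry σ p.1 ∧ entry σ p.1 > entry σ p.2).card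

/-- `𝒢_{n,k}`: the permutations of `[n]` with `k` valleys and no double descents. -/
def G (n k : ℕ) : Set (List ℕ) :=
  {σ | IsPermutation n σ ∧ (valleys σ).card = k ∧ doubleDescents σ = ∅}

/-- The subword `σ_{[m]}` of the letters `1, …, m` of a permutation `σ`. -/
def restrict (σ : List ℕ) (m : ℕ) : List ℕ :=
  σ.filter fun a => a ≤ m

/-- André permutations of `[n]`. (A nonempty word of positive letters without double descents
ends with an ascent, because of the convention `σₙ₊₁ = 0`.) -/
def IsAndre (n : ℕ) (σ : List ℕ) : Prop :=
  IsPermutation n σ ∧ ∀ m, 1 ≤ m → m ≤ n → doubleDescents (restrict σ m) = ∅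

/-- `𝔇_{n,k}`: the André permutations of `[n]` with `k` descents. -/
def D (n k : ℕ) : Set (List ℕ) :=
  {σ | IsAndre n σ ∧ des σ = k}

/-! The `x`-factorization `σ = w₁ w₂ x w₄ w₅`: the words `w₂` and `w₄` are the longest factors of
`σ` adjacent to the letter `x`, on its left and on its right, all of whose letters exceed `x`. -/

def w1 (σ : List ℕ) (x : ℕ) : List ℕ :=
  (σ.takeWhile fun a => a ≠ x).rdropWhile fun a => x < a

def w2 (σ : List ℕ) (x : ℕ) : List ℕ :=
  (σ.takeWhile fun a => a ≠ x).rtakeWhile fun a => x < a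

def w4 (σ : List ℕ) (x : ℕ) : List ℕ :=
  (σ.dropWhile fun a => a ≠ x).tail.takeWhile fun a => x < a

def w5 (σ : List ℕ) (x : ℕ) : List ℕ :=
  (σ.dropWhile fun a => a ≠ x).tail.dropWhile fun a => x < a

/-- The smallest letter of a nonempty word. -/
def minLetter (w : List ℕ) : ℕ :=
  w.min?.getD 0

def y1 (σ : List ℕ) (x : ℕ) : ℕ := minLetter (w2 σ x)

def y2 (σ : List ℕ) (x : ℕ) : ℕ := minLetter (w4 σ x)

/-- A valley `x` is of type I if `min y₁ y₂` is a peak or a double ascent. -/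
def IsTypeI (σ : List ℕ) (x : ℕ) : Prop :=
  min (y1 σ x) (y2 σ x) ∈ peaks σ ∨ min (y1 σ x) (y2 σ x) ∈ doubleAscents σ

/-- A valley `x` is of type II if `min y₁ y₂` is a valley. -/
def IsTypeII (σ : List ℕ) (x : ℕ) : Prop :=
  min (y1 σ x) (y2 σ x) ∈ valleys σ

instance (σ : List ℕ) : DecidablePred (IsTypeI σ) := fun x => by
  unfold IsTypeI; infer_instance

instance (σ : List ℕ) : DecidablePred (IsTypeII σ) := fun x => by
  unfold IsTypeII; infer_instance

/-- The transform `φ(σ, x)` at one valley `x` of a permutation `σ` without double descents, by the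
kind of the letter `y = min y₁ y₂`: a peak, a double ascent or a valley. In the third case `w₄`
(resp. `w₂`) is split as `w' y w''`. The value in the last branch is irrelevant. -/
def transform (σ : List ℕ) (x : ℕ) : List ℕ :=
  let y := min (y1 σ x) (y2 σ x)
  if y ∈ peaks σ then
    if y = y2 σ x then w1 σ x ++ [y] ++ [x] ++ w2 σ x ++ w5 σ x
    else w1 σ x ++ w4 σ x ++ [x] ++ [y] ++ w5 σ x
  else if y ∈ doubleAscents σ then
    if y = y2 σ x then w1 σ x ++ ([y] ++ w2 σ x) ++ [x] ++ (w4 σ x).tail ++ w5 σ x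
    else w1 σ x ++ (w2 σ x).tail ++ [x] ++ ([y] ++ w4 σ x) ++ w5 σ x
  else if y ∈ valleys σ then
    if y = y2 σ x then
      w1 σ x ++ (w2 σ x ++ [y] ++ (w4 σ x).takeWhile (fun a => a ≠ y)) ++ [x] ++
        ((w4 σ x).dropWhile fun a => a ≠ y).tail ++ w5 σ x
    else
      w1 σ x ++ ((w2 σ x).takeWhile fun a => a ≠ y) ++ [x] ++
        (((w2 σ x).dropWhile fun a => a ≠ y).tail ++ [y] ++ w4 σ x) ++ w5 σ x
  else σ

/-- Apply the transform successively at the letters of the list `l`, the head of `l` first. -/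
def transformList (σ : List ℕ) (l : List ℕ) : List ℕ :=
  l.foldl transform σ

/-- `S₁`: the elements of `S` that are of type I in `σ`. -/
def partI (σ : List ℕ) (S : Finset ℕ) : Finset ℕ :=
  S.filter fun x => IsTypeI σ x

/-- `S₂`: the elements of `S` that are of type II in `σ`. -/
def partII (σ : List ℕ) (S : Finset ℕ) : Finset ℕ :=
  S.filter fun x => IsTypeII σ x

/-- `φ(σ, S)` for a set `S` of valleys of `σ`: first the transforms at the valleys in `S` that are
of type I in `σ` (here in increasing order), then those at the valleys in `S` that are of type II
in `σ`, in decreasing order. -/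
def phi (σ : List ℕ) (S : Finset ℕ) : List ℕ :=
  transformList (transformList σ ((partI σ S).sort (· ≤ ·))) ((partII σ S).sort (· ≥ ·))

/-- The set of valleys of `σ` that corresponds to a set `S` of indices: if the valleys of `σ` are
`a₁ < a₂ < ⋯ < aₖ`, it consists of the `aᵢ` with `i ∈ S`. -/
def valleySubset (σ : List ℕ) (S : Finset ℕ) : Finset ℕ :=
  (valleys σ).filter fun a => ((valleys σ).filter fun b => b ≤ a).card ∈ S

end AndrePerm

/-! Read a permutation as the symmetric-order word of its increasing binary tree, whose root is the
smallest letter and whose two subtrees come from the factors on either side of it. Peaks, valleys,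
double ascents and double descents are then the leaves, the nodes with two children, with a right
child only and with a left child only (`sel_word_iff`). Hence the words in `G` are those of trees
without left-only nodes, and André permutations are those of trees in which every right child is
smaller than the left child, an empty child counting as `⊤` (`forall_trim_noLeftOnly_iff`).

In the factorization at a valley `x`, the factors `w2` and `w4` are the words of the two subtrees of
`x`. If the right root `y` is the smaller one, the word transform at `x` becomes the local operation
`rot` (`transform_word`). It keeps the type of every letter and reverses the order of the two
children of `x`.

Two such operations can interfere only when one letter is the root of the right subtree of the
other; then the larger letter must be treated first. If `x` and this root `y` both lie in `S`, then
`y` is a valley, so `x` is of type II and is treated after `y`: either `y` is of type I, or the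
decreasing order applies. Every permitted order therefore gives the bottom-up recursion `Phi`
(`foldl_op_eq_Phi`).

For bijectivity, work from the root. The order of the two children tells whether the root was
transformed, and the type of the left child tells which case of `rot` to invert (`Phi_injective`,
`exists_Phi_eq`).

For the statistics, `res` is the sum over nodes of the number of pairs formed by a letter `a` of the
left subtree and a maximal block of letters above `a` in the right subtree; `les` is the mirror
image. Moving `y` from the right of `x` to its left creates exactly one pair of the first kind and
destroys one of the second. Block counts are otherwise unchanged, so the contributions of the other
nodes are unaffected (`rot_resTree`, `rot_lesTree`, `Phi_blocks`). -/

namespace AndrePerm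

/-! ### Increasing binary trees and their words -/

/-- Binary trees labelled by natural numbers. -/
inductive ITree where
  | nil : ITree
  | node : ITree → ℕ → ITree → ITree

namespace ITree

/-- The word read off a tree in symmetric order. -/
def word : ITree → List ℕ
  | nil => []
  | node L m R => L.word ++ m :: R.word

def isNil : ITree → Bool
  | nil => true
  | node _ _ _ => false

/-- The label of the root, with `⊤` for the empty tree. -/
def root : ITree → WithTop ℕ
  | nil => ⊤
  | node _ m _ => m

/-- The labels exceed `b` and increase strictly along the branches. -/
def Incr : ℕ → ITree → Prop
  | _, nil => True
  | b, node L m R => b < m ∧ Incr m L ∧ Incr m R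

/-- `Sub s t`: the nonempty tree `s` is a (full) subtree of `t`. -/
def Sub (s : ITree) : ITree → Prop
  | nil => False
  | node L m R => s = node L m R ∨ Sub s L ∨ Sub s R

/-- `y` labels a node of `t` for which the emptiness of the two children satisfies `p`. -/
def Cls (p : Bool → Bool → Prop) : ITree → ℕ → Prop
  | nil, _ => False
  | node L m R, y => (y = m ∧ p L.isNil R.isNil) ∨ Cls p L y ∨ Cls p R y

/-- No node has a left child only. -/
def NoLeftOnly : ITree → Prop
  | nil => True
  | node L _ R => L.NoLeftOnly ∧ R.NoLeftOnly ∧ (R.isNil = true → L.isNil = true)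

/-- At every node with a left child, the right child is smaller than the left child. -/
def Andre : ITree → Prop
  | nil => True
  | node L _ R => L.Andre ∧ R.Andre ∧ R.root ≤ L.root

theorem isNil_iff {t : ITree} : t.isNil = true ↔ t = nil := by
  cases t <;> simp [isNil]

@[simp] theorem word_eq_nil {t : ITree} : t.word = [] ↔ t = nil := by
  cases t <;> simp [word]

theorem Incr.lt {t : ITree} : ∀ {b : ℕ}, t.Incr b → ∀ a ∈ t.word, b < a := by
  induction t with
  | nil => simp [word]
  | node L m R ihL ihR =>
    rintro b ⟨hb, hL, hR⟩ a ha
    simp only [word, List.mem_append, List.mem_cons] at ha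
    rcases ha with ha | rfl | ha
    · exact hb.trans (ihL hL a ha)
    · exact hb
    · exact hb.trans (ihR hR a ha)

theorem Incr.mono {t : ITree} {b c : ℕ} (h : t.Incr b) (hc : c ≤ b) : t.Incr c := by
  cases t with
  | nil => trivial
  | node L m R => exact ⟨hc.trans_lt h.1, h.2⟩

/-- Only the root is compared with the bound, so a subtree may be hung below any label smaller than
its root. This justifies each regrouping made by `rot` and its inverse. -/
theorem Incr.of_lt {t : ITree} {b c : ℕ} (h : t.Incr b) (hc : c < t.root) : t.Incr c := by
  cases t with
  | nil => trivial
  | node L m R => exact ⟨by simpa [root] using hc, h.2⟩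

theorem root_mem {t : ITree} {m : ℕ} (h : t.root = m) : m ∈ t.word := by
  cases t with
  | nil => simp [root] at h
  | node L m' R =>
    have : m' = m := by simpa [root] using h
    simp [word, this]

theorem Incr.root_gt {t : ITree} {b : ℕ} (h : t.Incr b) : (b : WithTop ℕ) < t.root := by
  cases t with
  | nil => simp [root]
  | node L m R => simpa [root] using h.1

theorem root_eq_top {t : ITree} : t.root = ⊤ ↔ t = nil := by
  cases t <;> simp [root]

/-- Every word with distinct letters exceeding `b` is the word of an increasing tree. -/
theorem exists_word_eq : ∀ (σ : List ℕ) (b : ℕ), (∀ a ∈ σ, b < a) → σ.Nodup →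
    ∃ t : ITree, t.Incr b ∧ t.word = σ := by
  intro σ
  induction hn : σ.length using Nat.strong_induction_on generalizing σ with
  | _ n ih =>
    intro b hb hσ
    by_cases h0 : σ = []
    · exact ⟨nil, trivial, by simp [word, h0]⟩
    obtain ⟨m, hm⟩ : ∃ m, m ∈ σ ∧ ∀ a ∈ σ, m ≤ a := by
      have hne : σ.toFinset.Nonempty := by simpa [List.toFinset_nonempty_iff] using h0
      exact ⟨σ.toFinset.min' hne, by simpa using σ.toFinset.min'_mem hne,
        fun a ha => σ.toFinset.min'_le a (by simpa using ha)⟩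
    obtain ⟨u, v, rfl⟩ := List.append_of_mem hm.1
    have hd := List.nodup_append.1 hσ
    have hd2 := List.nodup_cons.1 hd.2.1
    have hu : ∀ a ∈ u, m < a := fun a ha =>
      lt_of_le_of_ne (hm.2 a (by simp [ha])) (fun h => hd.2.2 a ha m (by simp) h.symm)
    have hv : ∀ a ∈ v, m < a := fun a ha =>
      lt_of_le_of_ne (hm.2 a (by simp [ha])) (fun h => hd2.1 (h ▸ ha))
    have hlen : (u ++ m :: v).length = u.length + v.length + 1 := by simp; omega
    obtain ⟨L, hL, hLu⟩ := ih u.length (by omega) u rfl m hu hd.1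
    obtain ⟨R, hR, hRv⟩ := ih v.length (by omega) v rfl m hv hd2.2
    exact ⟨node L m R, ⟨hb m (by simp), hL, hR⟩, by simp [word, hLu, hRv]⟩

/-- An increasing tree is determined by its word. -/
theorem word_injective : ∀ {t t' : ITree} {b b' : ℕ}, t.Incr b → t'.Incr b' →
    t.word = t'.word → t = t' := by
  intro t
  induction t with
  | nil =>
    intro t' b b' _ _ h
    exact (word_eq_nil.1 h.symm).symm
  | node L m R ihL ihR =>
    intro t' b b' h h' he
    cases t' with
    | nil => simp [word] at he
    | node L' m' R' =>
      simp only [word] at he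
      have hmL : ∀ a ∈ (node L m R).word, m ≤ a := by
        intro a ha
        simp only [word, List.mem_append, List.mem_cons] at ha
        rcases ha with ha | rfl | ha
        exacts [(h.2.1.lt a ha).le, le_rfl, (h.2.2.lt a ha).le]
      have hmL' : ∀ a ∈ (node L' m' R').word, m' ≤ a := by
        intro a ha
        simp only [word, List.mem_append, List.mem_cons] at ha
        rcases ha with ha | rfl | ha
        exacts [(h'.2.1.lt a ha).le, le_rfl, (h'.2.2.lt a ha).le]
      simp only [word] at hmL hmL'
      have hmm : m = m' := le_antisymm (hmL _ (by rw [he]; simp)) (hmL' _ (by rw [← he]; simp))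
      subst hmm
      have n1 : m ∉ L.word := fun hm => lt_irrefl _ (h.2.1.lt m hm)
      have n2 : m ∉ L'.word := fun hm => lt_irrefl _ (h'.2.1.lt m hm)
      have hR1 : m ∉ R.word := fun hm => lt_irrefl _ (h.2.2.lt m hm)
      have key := List.append_eq_append_iff.1 he
      have : L.word = L'.word ∧ R.word = R'.word := by
        rcases key with ⟨as, h1, h2⟩ | ⟨as, h1, h2⟩
        · cases as with
          | nil => simp_all
          | cons c as =>
            simp only [List.cons_append, List.cons.injEq] at h2
            exact absurd (by rw [h1, h2.1]; simp) n2
        · cases as with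
          | nil => simp_all
          | cons c as =>
            simp only [List.cons_append, List.cons.injEq] at h2
            exact absurd (by rw [h1, h2.1]; simp) n1
      rw [ihL h.2.1 h'.2.1 this.1, ihR h.2.2 h'.2.2 this.2]

/-! ### Locating nodes by their labels -/

theorem Sub.mem_word {t A B : ITree} {x : ℕ} (h : Sub (node A x B) t) : x ∈ t.word := by
  induction t with
  | nil => exact h.elim
  | node L m R ihL ihR =>
    rcases h with h | h | h
    · cases h; simp [word]
    · simp [word, ihL h]
    · simp [word, ihR h]

theorem exists_sub {t : ITree} {x : ℕ} (h : x ∈ t.word) : ∃ A B, Sub (node A x B) t := by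
  induction t with
  | nil => simp [word] at h
  | node L m R ihL ihR =>
    simp only [word, List.mem_append, List.mem_cons] at h
    rcases h with h | rfl | h
    · obtain ⟨A, B, h⟩ := ihL h; exact ⟨A, B, Or.inr (Or.inl h)⟩
    · exact ⟨L, R, Or.inl rfl⟩
    · obtain ⟨A, B, h⟩ := ihR h; exact ⟨A, B, Or.inr (Or.inr h)⟩

theorem Sub.right {t A C D : ITree} {x y : ℕ} (h : Sub (node A x (node C y D)) t) :
    Sub (node C y D) t := by
  induction t with
  | nil => exact h.elim
  | node L m R ihL ihR =>
    rcases h with h | h | h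
    · cases h; exact Or.inr (Or.inr (Or.inl rfl))
    · exact Or.inr (Or.inl (ihL h))
    · exact Or.inr (Or.inr (ihR h))

theorem nodup_node {L R : ITree} {m : ℕ} (h : (node L m R).word.Nodup) :
    L.word.Nodup ∧ R.word.Nodup ∧ m ∉ L.word ∧ m ∉ R.word ∧
      ∀ a ∈ L.word, a ∉ R.word := by
  simp only [word] at h
  have hd := List.nodup_append.1 h
  have hd2 := List.nodup_cons.1 hd.2.1
  exact ⟨hd.1, hd2.2, fun hm => hd.2.2 m hm m (by simp) rfl, hd2.1,
    fun a ha ha' => hd.2.2 a ha a (by simp [ha']) rfl⟩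

theorem Sub.unique {t A B A' B' : ITree} {x : ℕ} (hn : t.word.Nodup)
    (h : Sub (node A x B) t) (h' : Sub (node A' x B') t) : A = A' ∧ B = B' := by
  induction t with
  | nil => exact h.elim
  | node L m R ihL ihR =>
    obtain ⟨hL, hR, h1, h2, h3⟩ := nodup_node hn
    rcases h with h | h | h <;> rcases h' with h' | h' | h'
    · cases h; cases h'; exact ⟨rfl, rfl⟩
    · cases h; exact absurd h'.mem_word h1
    · cases h; exact absurd h'.mem_word h2
    · cases h'; exact absurd h.mem_word h1
    · exact ihL hL h h'
    · exact absurd h'.mem_word (h3 x h.mem_word)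
    · cases h'; exact absurd h.mem_word h2
    · exact absurd h.mem_word (h3 x h'.mem_word)
    · exact ihR hR h h'

theorem cls_iff {p : Bool → Bool → Prop} {t : ITree} {y : ℕ} :
    Cls p t y ↔ ∃ A B, Sub (node A y B) t ∧ p A.isNil B.isNil := by
  induction t with
  | nil => simp [Cls, Sub]
  | node L m R ihL ihR =>
    simp only [Cls, Sub, ihL, ihR]
    constructor
    · rintro (⟨rfl, h⟩ | ⟨A, B, h, h'⟩ | ⟨A, B, h, h'⟩)
      exacts [⟨L, R, Or.inl rfl, h⟩, ⟨A, B, Or.inr (Or.inl h), h'⟩, ⟨A, B, Or.inr (Or.inr h), h'⟩]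
    · rintro ⟨A, B, h | h | h, h'⟩
      · cases h; exact Or.inl ⟨rfl, h'⟩
      · exact Or.inr (Or.inl ⟨A, B, h, h'⟩)
      · exact Or.inr (Or.inr ⟨A, B, h, h'⟩)

theorem Cls.mem_word {p : Bool → Bool → Prop} {t : ITree} {y : ℕ} (h : Cls p t y) :
    y ∈ t.word := by
  obtain ⟨A, B, h, -⟩ := cls_iff.1 h
  exact h.mem_word

theorem cls_of_sub {p : Bool → Bool → Prop} {t A B : ITree} {y : ℕ} (hn : t.word.Nodup)
    (h : Sub (node A y B) t) : Cls p t y ↔ p A.isNil B.isNil := by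
  rw [cls_iff]
  constructor
  · rintro ⟨A', B', h', hp⟩
    obtain ⟨rfl, rfl⟩ := h.unique hn h'
    exact hp
  · exact fun hp => ⟨A, B, h, hp⟩

theorem Andre.sub {t A B : ITree} {x : ℕ} (ht : t.Andre) (h : Sub (node A x B) t) :
    (node A x B).Andre := by
  induction t with
  | nil => exact h.elim
  | node L m R ihL ihR =>
    rcases h with h | h | h
    · rw [h]; exact ht
    · exact ihL ht.1 h
    · exact ihR ht.2.1 h

theorem Andre.noLeftOnly {t : ITree} (h : t.Andre) : t.NoLeftOnly := by
  induction t with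
  | nil => trivial
  | node L m R ihL ihR =>
    refine ⟨ihL h.1, ihR h.2.1, fun hR => ?_⟩
    rw [isNil_iff] at hR ⊢
    have := h.2.2
    rw [hR] at this
    exact root_eq_top.1 (top_le_iff.1 this)

theorem noLeftOnly_iff {t : ITree} :
    t.NoLeftOnly ↔ ∀ y, ¬ Cls (fun l r => l = false ∧ r = true) t y := by
  induction t with
  | nil => simp [NoLeftOnly, Cls]
  | node L m R ihL ihR =>
    simp only [NoLeftOnly, Cls, ihL, ihR]
    constructor
    · rintro ⟨h1, h2, h3⟩ y (⟨rfl, h, h'⟩ | h | h)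
      · simp [h3 h'] at h
      · exact h1 y h
      · exact h2 y h
    · intro h
      refine ⟨fun y hy => h y (by simp [hy]), fun y hy => h y (by simp [hy]), fun hR => ?_⟩
      by_contra hL
      exact h m (Or.inl ⟨rfl, by simpa using hL, hR⟩)

theorem root_ne_of_disjoint {L R : ITree} (h : ∀ a ∈ L.word, a ∉ R.word) (hL : L ≠ nil) :
    L.root ≠ R.root := by
  cases L with
  | nil => exact absurd rfl hL
  | node A y B => exact fun he => h y (by simp [word]) (root_mem he.symm)

end ITree

/-! ### Types of letters as types of nodes -/

/-- The letters `a` of a word with `P l a r`, where `l` and `r` are the neighbours of `a`; the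
word is preceded by `l` and followed by `r`. -/
def sel (P : ℕ → ℕ → ℕ → Prop) : ℕ → ℕ → List ℕ → ℕ → Prop
  | _, _, [], _ => False
  | l, r, a :: w, y => (y = a ∧ P l a (w.headD r)) ∨ sel P a r w y

/-- Cutting at `m` makes `m` the outer neighbour of both halves, which matches the recursion at the
root of a tree. -/
theorem sel_append (P : ℕ → ℕ → ℕ → Prop) (r m y : ℕ) (v : List ℕ) : ∀ (u : List ℕ) (l : ℕ),
    sel P l r (u ++ m :: v) y ↔
      sel P l m u y ∨ (y = m ∧ P (u.getLastD l) m (v.headD r)) ∨ sel P m r v y := by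
  intro u
  induction u with
  | nil => intro l; simp [sel]
  | cons a u ih =>
    intro l
    have : (u ++ m :: v).headD r = u.headD m := by cases u <;> simp
    simp only [List.cons_append, sel, ih a, this, List.getLastD_cons, or_assoc]

theorem exists_entry_iff_sel (P : ℕ → ℕ → ℕ → Prop) (y : ℕ) : ∀ (w : List ℕ) (l : ℕ),
    (∃ i, i < w.length ∧ P ((l :: w).getD i 0) ((l :: w).getD (i + 1) 0)
      ((l :: w).getD (i + 2) 0) ∧ (l :: w).getD (i + 1) 0 = y) ↔ sel P l 0 w y := by
  intro w
  induction w with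
  | nil => intro l; simp [sel]
  | cons a w ih =>
    intro l
    have hh : w.getD 0 0 = w.headD 0 := by cases w <;> simp
    rw [sel, ← ih a]
    constructor
    · rintro ⟨i, hi, hP, hy⟩
      cases i with
      | zero =>
        left
        simp only [List.getD_cons_succ, List.getD_cons_zero, hh] at hP hy
        exact ⟨hy.symm, hP⟩
      | succ i =>
        right
        exact ⟨i, by simpa using hi, by simpa only [List.getD_cons_succ] using hP,
          by simpa only [List.getD_cons_succ] using hy⟩
    · rintro (⟨rfl, hP⟩ | ⟨i, hi, hP, hy⟩)
      · exact ⟨0, by simp, by simpa only [List.getD_cons_succ, List.getD_cons_zero, hh] using hP,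
          by simp⟩
      · exact ⟨i + 1, by simpa using hi, by simpa only [List.getD_cons_succ] using hP,
          by simpa only [List.getD_cons_succ] using hy⟩

theorem mem_image_entry_iff (P : ℕ → ℕ → ℕ → Prop) (σ : List ℕ) (y : ℕ) (F : Finset ℕ)
    (hF : ∀ i, i ∈ F ↔ (1 ≤ i ∧ i ≤ σ.length) ∧
      P (entry σ (i - 1)) (entry σ i) (entry σ (i + 1))) :
    y ∈ F.image (entry σ) ↔ sel P 0 0 σ y := by
  rw [← exists_entry_iff_sel]
  simp only [Finset.mem_image, hF]
  constructor
  · rintro ⟨i, ⟨⟨h1, h2⟩, h3⟩, h4⟩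
    obtain ⟨j, rfl⟩ : ∃ j, i = j + 1 := ⟨i - 1, by omega⟩
    exact ⟨j, by omega, h3, h4⟩
  · rintro ⟨i, h1, h2, h3⟩
    exact ⟨i + 1, ⟨⟨by omega, by omega⟩, h2⟩, h3⟩

theorem mem_peaks_iff (σ : List ℕ) (y : ℕ) :
    y ∈ peaks σ ↔ sel (fun l a r => l < a ∧ a > r) 0 0 σ y :=
  mem_image_entry_iff _ σ y _ (by simp)

theorem mem_valleys_iff (σ : List ℕ) (y : ℕ) :
    y ∈ valleys σ ↔ sel (fun l a r => l > a ∧ a < r) 0 0 σ y :=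
  mem_image_entry_iff _ σ y _ (by simp)

theorem mem_doubleAscents_iff (σ : List ℕ) (y : ℕ) :
    y ∈ doubleAscents σ ↔ sel (fun l a r => l < a ∧ a < r) 0 0 σ y :=
  mem_image_entry_iff _ σ y _ (by simp)

theorem mem_doubleDescents_iff (σ : List ℕ) (y : ℕ) :
    y ∈ doubleDescents σ ↔ sel (fun l a r => l > a ∧ a > r) 0 0 σ y :=
  mem_image_entry_iff _ σ y _ (by simp)

namespace ITree

theorem Incr.getLastD_word {t : ITree} {m l : ℕ} (h : t.Incr m) (hl : l < m) :
    (t.isNil = true ∧ t.word.getLastD l < m) ∨ (t.isNil = false ∧ m < t.word.getLastD l) := by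
  cases t with
  | nil => simp [isNil, word, hl]
  | node A y B =>
    right
    refine ⟨rfl, h.lt _ ?_⟩
    have : (node A y B).word ≠ [] := by simp
    rw [List.getLastD_eq_getLast?, List.getLast?_eq_some_getLast this]
    exact List.getLast_mem this

theorem Incr.headD_word {t : ITree} {m r : ℕ} (h : t.Incr m) (hr : r < m) :
    (t.isNil = true ∧ t.word.headD r < m) ∨ (t.isNil = false ∧ m < t.word.headD r) := by
  cases t with
  | nil => simp [isNil, word, hr]
  | node A y B =>
    right
    refine ⟨rfl, h.lt _ ?_⟩
    have : (node A y B).word ≠ [] := by simp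
    rw [List.headD_eq_head?_getD, List.head?_eq_some_head this]
    exact List.head_mem this

/-- The letters of a subtree of `m` exceed `m`, whereas the outer neighbours `l` and `r` are below
it. A neighbour of `m` is thus smaller than `m` exactly when the subtree on that side is empty, so
any condition on these comparisons is one on empty children. -/
theorem sel_word_iff {P : ℕ → ℕ → ℕ → Prop} {p : Bool → Bool → Prop}
    (hP : ∀ l a r : ℕ, l ≠ a → r ≠ a → (P l a r ↔ p (decide (l < a)) (decide (r < a)))) (y : ℕ)
    {t : ITree} : ∀ {b l r : ℕ}, t.Incr b → l ≤ b → r ≤ b → (sel P l r t.word y ↔ Cls p t y) := by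
  induction t with
  | nil => simp [sel, word, Cls]
  | node L m R ihL ihR =>
    intro b l r h hl hr
    have hlm := hl.trans_lt h.1
    have hrm := hr.trans_lt h.1
    rw [word, sel_append, ihL h.2.1 hlm.le le_rfl, ihR h.2.2 le_rfl hrm.le, Cls]
    have : P (L.word.getLastD l) m (R.word.headD r) ↔ p L.isNil R.isNil := by
      have h1 := h.2.1.getLastD_word hlm
      have h2 := h.2.2.headD_word hrm
      rw [hP _ _ _ (by omega) (by omega)]
      have e1 : decide (L.word.getLastD l < m) = L.isNil := by
        rcases h1 with ⟨h, h'⟩ | ⟨h, h'⟩ <;>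
          simp only [h, decide_eq_true_eq, decide_eq_false_iff_not] <;> omega
      have e2 : decide (R.word.headD r < m) = R.isNil := by
        rcases h2 with ⟨h, h'⟩ | ⟨h, h'⟩ <;>
          simp only [h, decide_eq_true_eq, decide_eq_false_iff_not] <;> omega
      rw [e1, e2]
    rw [this]
    tauto

theorem mem_peaks_word {t : ITree} {b : ℕ} (h : t.Incr b) (y : ℕ) :
    y ∈ peaks t.word ↔ Cls (fun l r => l = true ∧ r = true) t y := by
  rw [mem_peaks_iff]
  exact sel_word_iff (by intro l a r _ _; simp) y (h.mono (Nat.zero_le _)) le_rfl le_rfl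

theorem mem_valleys_word {t : ITree} {b : ℕ} (h : t.Incr b) (y : ℕ) :
    y ∈ valleys t.word ↔ Cls (fun l r => l = false ∧ r = false) t y := by
  rw [mem_valleys_iff]
  exact sel_word_iff (by intro l a r _ _; simp; omega) y (h.mono (Nat.zero_le _)) le_rfl le_rfl

theorem mem_doubleAscents_word {t : ITree} {b : ℕ} (h : t.Incr b) (y : ℕ) :
    y ∈ doubleAscents t.word ↔ Cls (fun l r => l = true ∧ r = false) t y := by
  rw [mem_doubleAscents_iff]
  exact sel_word_iff (by intro l a r _ _; simp; omega) y (h.mono (Nat.zero_le _)) le_rfl le_rfl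

theorem mem_doubleDescents_word {t : ITree} {b : ℕ} (h : t.Incr b) (y : ℕ) :
    y ∈ doubleDescents t.word ↔ Cls (fun l r => l = false ∧ r = true) t y := by
  rw [mem_doubleDescents_iff]
  exact sel_word_iff (by intro l a r _ _; simp; omega) y (h.mono (Nat.zero_le _)) le_rfl le_rfl

theorem doubleDescents_word_eq_empty {t : ITree} {b : ℕ} (h : t.Incr b) :
    doubleDescents t.word = ∅ ↔ t.NoLeftOnly := by
  rw [noLeftOnly_iff, Finset.eq_empty_iff_forall_notMem]
  simp only [mem_doubleDescents_word h]

/-! ### Counting valleys and descents -/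

/-- The number of nodes with two children whose label is selected by `S`. -/
def numBinary (S : ℕ → Bool) : ITree → ℕ
  | nil => 0
  | node L m R => L.numBinary S + R.numBinary S +
      if S m = true ∧ L.isNil = false ∧ R.isNil = false then 1 else 0

theorem valleys_word_node {L R : ITree} {m b : ℕ} (h : (node L m R).Incr b) :
    valleys (node L m R).word = (if L.isNil = false ∧ R.isNil = false then {m} else ∅) ∪
      (valleys L.word ∪ valleys R.word) := by
  ext y
  rw [mem_valleys_word h, Cls, Finset.mem_union, Finset.mem_union, mem_valleys_word h.2.1,
    mem_valleys_word h.2.2]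
  by_cases hc : L.isNil = false ∧ R.isNil = false
  · rw [if_pos hc]; simp [hc]
  · rw [if_neg hc]; simp [hc]

theorem card_filter_valleys_word (S : ℕ → Bool) {t : ITree} : ∀ {b : ℕ}, t.Incr b →
    t.word.Nodup → ((valleys t.word).filter fun x => S x = true).card = t.numBinary S := by
  induction t with
  | nil => intros; simp [word, numBinary, valleys]
  | node L m R ihL ihR =>
    intro b h hn
    obtain ⟨nL, nR, h1, h2, h3⟩ := nodup_node hn
    have sL : ∀ x ∈ valleys L.word, x ∈ L.word := fun x hx =>
      ((mem_valleys_word h.2.1 x).1 hx).mem_word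
    have sR : ∀ x ∈ valleys R.word, x ∈ R.word := fun x hx =>
      ((mem_valleys_word h.2.2 x).1 hx).mem_word
    rw [valleys_word_node h, Finset.filter_union, Finset.filter_union, Finset.card_union_of_disjoint,
      Finset.card_union_of_disjoint, ihL h.2.1 nL, ihR h.2.2 nR, numBinary, add_comm]
    · congr 1
      by_cases hc : L.isNil = false ∧ R.isNil = false
      · by_cases hS : S m = true <;> simp [hc, hS, Finset.filter_singleton]
      · simp [hc]
    · rw [Finset.disjoint_left]
      intro x hx hx'
      exact h3 x (sL x (Finset.mem_filter.1 hx).1) (sR x (Finset.mem_filter.1 hx').1)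
    · rw [Finset.disjoint_left]
      intro x hx hx'
      have hxm : x = m := by
        have := (Finset.mem_filter.1 hx).1
        split_ifs at this <;> simp_all
      subst hxm
      rcases Finset.mem_union.1 hx' with hx' | hx'
      · exact h1 (sL _ (Finset.mem_filter.1 hx').1)
      · exact h2 (sR _ (Finset.mem_filter.1 hx').1)

/-- The number of descents of a word preceded by `l`. -/
def desFrom : ℕ → List ℕ → ℕ
  | _, [] => 0
  | l, a :: w => (if l > a then 1 else 0) + desFrom a w

theorem desFrom_append (u v : List ℕ) (m : ℕ) : ∀ l,
    desFrom l (u ++ m :: v) = desFrom l u + (if u.getLastD l > m then 1 else 0) + desFrom m v := by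
  induction u with
  | nil => intro l; simp [desFrom]
  | cons a u ih => intro l; simp only [List.cons_append, desFrom, ih, List.getLastD_cons]; omega

theorem card_filter_descents (w : List ℕ) : ∀ l : ℕ,
    ((Finset.range w.length).filter fun i =>
      (l :: w).getD i 0 > (l :: w).getD (i + 1) 0).card = desFrom l w := by
  induction w with
  | nil => intro l; simp [desFrom]
  | cons a w ih =>
    intro l
    rw [desFrom, ← ih a, Finset.card_filter, Finset.card_filter, List.length_cons,
      Finset.sum_range_succ', add_comm]
    simp only [List.getD_cons_succ, List.getD_cons_zero]

theorem des_eq_desFrom (σ : List ℕ) : des σ = desFrom 0 σ := by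
  rw [← card_filter_descents]
  unfold des entry
  refine Finset.card_bij' (fun i _ => i) (fun i _ => i) ?_ ?_ (by simp) (by simp)
  · simp only [Finset.mem_filter, Finset.mem_Ico, Finset.mem_range]
    rintro i ⟨h1, h2⟩; exact ⟨h1.2, h2⟩
  · simp only [Finset.mem_filter, Finset.mem_Ico, Finset.mem_range]
    rintro i ⟨h1, h2⟩
    refine ⟨⟨?_, h1⟩, h2⟩
    rcases Nat.eq_zero_or_pos i with rfl | h
    · simp at h2
    · exact h

/-- There is a descent into `m` exactly when its left subtree is nonempty, and without left-only
nodes this means that `m` has two children. -/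
theorem desFrom_word {t : ITree} (hN : t.NoLeftOnly) : ∀ {b l : ℕ}, t.Incr b → l ≤ b →
    desFrom l t.word = t.numBinary fun _ => true := by
  induction t with
  | nil => intros; simp [desFrom, word, numBinary]
  | node L m R ihL ihR =>
    intro b l h hl
    have hlm := hl.trans_lt h.1
    rw [word, desFrom_append, ihL hN.1 h.2.1 hlm.le, ihR hN.2.1 h.2.2 le_rfl, numBinary]
    have h3 := hN.2.2
    rcases h.2.1.getLastD_word hlm with ⟨h1, h2⟩ | ⟨h1, h2⟩
    · rw [if_neg (by omega), if_neg (by simp [h1])]; omega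
    · rw [if_pos h2, if_pos]
      · omega
      · refine ⟨rfl, h1, ?_⟩
        by_contra hc
        simp [h3 (by simpa using hc)] at h1

theorem des_word {t : ITree} {b : ℕ} (hN : t.NoLeftOnly) (h : t.Incr b) (hn : t.word.Nodup) :
    des t.word = (valleys t.word).card := by
  rw [des_eq_desFrom, desFrom_word hN h (Nat.zero_le _), ← card_filter_valleys_word _ h hn]
  simp

/-! ### Subwords of small letters and the André condition -/

/-- The tree of the letters at most `k`. -/
def trim (k : ℕ) : ITree → ITree
  | nil => nil
  | node L m R => if m ≤ k then node (trim k L) m (trim k R) else nil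

theorem word_trim (k : ℕ) {t : ITree} : ∀ {b : ℕ}, t.Incr b →
    (trim k t).word = restrict t.word k := by
  induction t with
  | nil => intros; simp [trim, word, restrict]
  | node L m R ihL ihR =>
    intro b h
    unfold restrict at *
    by_cases hm : m ≤ k
    · simp only [trim, if_pos hm, word, ihL h.2.1, ihR h.2.2, List.filter_append]
      rw [List.filter_cons_of_pos (by simpa using hm)]
    · rw [trim, if_neg hm, eq_comm, word, List.filter_eq_nil_iff]
      intro a ha
      have : m ≤ a := by
        simp only [word, List.mem_append, List.mem_cons] at ha
        rcases ha with ha | rfl | ha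
        exacts [(h.2.1.lt a ha).le, le_rfl, (h.2.2.lt a ha).le]
      simp; omega

theorem Incr.trim {t : ITree} (k : ℕ) : ∀ {b : ℕ}, t.Incr b → (t.trim k).Incr b := by
  induction t with
  | nil => intros; trivial
  | node L m R ihL ihR =>
    intro b h
    rw [ITree.trim]
    split_ifs
    · exact ⟨h.1, ihL h.2.1, ihR h.2.2⟩
    · trivial

theorem isNil_trim {t : ITree} (k : ℕ) : (t.trim k).isNil = true ↔ (k : WithTop ℕ) < t.root := by
  cases t with
  | nil => simp [trim, isNil, root]
  | node L m R =>
    rw [trim]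
    split_ifs with h
    · simp [isNil, root, h]
    · simpa [isNil, root] using h

/-- A node of the trimmed tree is left-only when the left root is at most `k` and the right root
exceeds `k`. No `k` separates the roots in this way precisely when the right root is at most the
left one; the critical value is `k = L.root`. -/
theorem forall_trim_noLeftOnly_iff {t : ITree} : ∀ {b : ℕ}, t.Incr b →
    ((∀ k, (t.trim k).NoLeftOnly) ↔ t.Andre) := by
  induction t with
  | nil => intros; simp [trim, NoLeftOnly, Andre]
  | node L m R ihL ihR =>
    intro b h
    rw [Andre, ← ihL h.2.1, ← ihR h.2.2]
    have key : ∀ k, (trim k (node L m R)).NoLeftOnly ↔ (trim k L).NoLeftOnly ∧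
        (trim k R).NoLeftOnly ∧ ((k : WithTop ℕ) < R.root → (k : WithTop ℕ) < L.root) := by
      intro k
      rw [trim]
      split_ifs with hk
      · rw [NoLeftOnly, isNil_trim, isNil_trim]
      · have hL : (k : WithTop ℕ) < L.root :=
          lt_trans (by simpa using hk) h.2.1.root_gt
        have hR : (k : WithTop ℕ) < R.root :=
          lt_trans (by simpa using hk) h.2.2.root_gt
        have hL' := isNil_iff.1 ((isNil_trim k).2 hL)
        have hR' := isNil_iff.1 ((isNil_trim k).2 hR)
        simp [hL', hR', hL, NoLeftOnly]
    simp only [key]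
    constructor
    · intro h
      refine ⟨fun k => (h k).1, fun k => (h k).2.1, ?_⟩
      by_contra hc
      push Not at hc
      obtain ⟨k, hk⟩ : ∃ k : ℕ, L.root = k := by
        cases L with
        | nil => simp [root] at hc
        | node A y B => exact ⟨y, rfl⟩
      have := (h k).2.2 (hk ▸ hc)
      simp [hk] at this
    · rintro ⟨h1, h2, h3⟩ k
      exact ⟨h1 k, h2 k, fun h => h.trans_le h3⟩

theorem isAndre_word_iff {t : ITree} {n : ℕ} (h : t.Incr 0) :
    IsAndre n t.word ↔ IsPermutation n t.word ∧ t.Andre := by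
  unfold IsAndre
  refine and_congr_right fun hp => ?_
  rw [← forall_trim_noLeftOnly_iff h]
  have key : ∀ k, doubleDescents (restrict t.word k) = ∅ ↔ (t.trim k).NoLeftOnly := fun k => by
    rw [← word_trim k h, doubleDescents_word_eq_empty (h.trim k)]
  simp only [key]
  refine ⟨fun hk k => ?_, fun hk k _ _ => hk k⟩
  -- The André condition only concerns `1 ≤ k ≤ n`. For `k = 0` the trimmed tree is empty, and for
  -- `k > n` the subword is the same as for `n`.
  rcases Nat.eq_zero_or_pos k with rfl | hk0
  · have : t.trim 0 = nil := isNil_iff.1 ((isNil_trim 0).2 h.root_gt)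
    rw [this]; trivial
  by_cases hkn : k ≤ n
  · exact hk k hk0 hkn
  · rw [← key]
    have : restrict t.word k = restrict t.word n := by
      unfold restrict
      refine List.filter_congr fun a ha => ?_
      have := hp.mem_iff.1 ha
      simp [List.mem_range'] at this ⊢
      omega
    rw [this, key]
    rcases Nat.eq_zero_or_pos n with rfl | hn
    · have : t.trim 0 = nil := isNil_iff.1 ((isNil_trim 0).2 h.root_gt)
      rw [this]; trivial
    · exact hk n hn le_rfl

/-! ### The transform on trees -/

/-- The transform at the root: the left subtree is moved below (or exchanged with) the root `y` of
the right subtree. -/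
def rot (L : ITree) (m : ℕ) (R : ITree) : ITree :=
  match L, R with
  | nil, R => node nil m R
  | L, nil => node L m nil
  | L, node A y B =>
    if A.isNil then if B.isNil then node (node nil y nil) m L else node (node nil y L) m B
    else node (node L y A) m B

/-- The transform at the node with label `x`. -/
def op : ITree → ℕ → ITree
  | nil, _ => nil
  | node L m R, x => if m = x then rot L m R else node (op L x) m (op R x)

/-- The transforms at all the nodes whose labels are selected by `S`, from the leaves to the
root. -/
def Phi (S : ℕ → Bool) : ITree → ITree
  | nil => nil
  | node L m R => if S m then rot (Phi S L) m (Phi S R) else node (Phi S L) m (Phi S R)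

@[simp] theorem isNil_nil : nil.isNil = true := rfl

@[simp] theorem isNil_node (L : ITree) (m : ℕ) (R : ITree) : (node L m R).isNil = false := rfl

/-- The possible shapes of the transform at the root. -/
theorem rot_cases {motive : ITree → ℕ → ITree → ITree → Prop}
    (h1 : ∀ m R, motive nil m R (node nil m R))
    (h2 : ∀ L m, motive L m nil (node L m nil))
    (h3 : ∀ L m y, L ≠ nil → motive L m (node nil y nil) (node (node nil y nil) m L))
    (h4 : ∀ L m y B, L ≠ nil → B ≠ nil → motive L m (node nil y B) (node (node nil y L) m B))
    (h5 : ∀ L m A y B, L ≠ nil → A ≠ nil → motive L m (node A y B) (node (node L y A) m B))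
    (L : ITree) (m : ℕ) (R : ITree) : motive L m R (rot L m R) := by
  cases L with
  | nil => exact h1 m R
  | node C z D =>
    cases R with
    | nil => exact h2 _ _
    | node A y B =>
      cases A with
      | nil =>
        cases B with
        | nil => exact h3 _ _ _ (by simp)
        | node E w F => exact h4 _ _ _ _ (by simp) (by simp)
      | node E w F => exact h5 _ _ _ _ _ (by simp) (by simp)

@[simp] theorem rot_nil_left (m : ℕ) (R : ITree) : rot nil m R = node nil m R := rfl

@[simp] theorem rot_nil_right (L : ITree) (m : ℕ) : rot L m nil = node L m nil := by
  cases L <;> rfl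

theorem rot_leaf {L : ITree} (m y : ℕ) (hL : L ≠ nil) :
    rot L m (node nil y nil) = node (node nil y nil) m L := by
  cases L
  · exact absurd rfl hL
  · rfl

theorem rot_chain {L B : ITree} (m y : ℕ) (hL : L ≠ nil) (hB : B ≠ nil) :
    rot L m (node nil y B) = node (node nil y L) m B := by
  cases L
  · exact absurd rfl hL
  · cases B
    · exact absurd rfl hB
    · rfl

theorem rot_binary {L A : ITree} (m y : ℕ) (B : ITree) (hL : L ≠ nil) (hA : A ≠ nil) :
    rot L m (node A y B) = node (node L y A) m B := by
  cases L
  · exact absurd rfl hL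
  · cases A
    · exact absurd rfl hA
    · rfl

theorem rot_root (L : ITree) (m : ℕ) (R : ITree) : (rot L m R).root = m := by
  refine rot_cases (motive := fun _ m _ t => t.root = m) ?_ ?_ ?_ ?_ ?_ L m R <;>
    intros <;> rfl

theorem rot_word_perm (L : ITree) (m : ℕ) (R : ITree) :
    (rot L m R).word.Perm (node L m R).word := by
  refine rot_cases (motive := fun L m R t => t.word.Perm (node L m R).word) ?_ ?_ ?_ ?_ ?_ L m R
  · intros; rfl
  · intros; rfl
  all_goals
    intros
    rw [← Multiset.coe_eq_coe]
    simp only [word, ← Multiset.coe_add, ← Multiset.cons_coe, ← Multiset.singleton_add,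
      List.nil_append, Multiset.coe_nil]
    abel

/-- In each case `m` keeps two children and `y` keeps its type. When `y` has a left child, this
needs its right child to be nonempty as well, which is where `NoLeftOnly` enters. -/
theorem rot_cls (p : Bool → Bool → Prop) (L : ITree) (m : ℕ) (R : ITree) (x : ℕ)
    (hR : R.NoLeftOnly) : Cls p (rot L m R) x ↔ Cls p (node L m R) x := by
  refine rot_cases (motive := fun L m R t => R.NoLeftOnly → (Cls p t x ↔ Cls p (node L m R) x))
    ?_ ?_ ?_ ?_ ?_ L m R hR
  · intros; rfl
  · intros; rfl
  · intro L m y hL _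
    have := mt isNil_iff.1 hL
    simp only [Bool.not_eq_true] at this
    simp only [Cls, this, isNil_nil, isNil_node]
    tauto
  · intro L m y B hL hB _
    have h1 := mt isNil_iff.1 hL
    have h2 := mt isNil_iff.1 hB
    simp only [Bool.not_eq_true] at h1 h2
    simp only [Cls, h1, h2, isNil_nil, isNil_node]
    tauto
  · intro L m A y B hL hA hR
    have h1 := mt isNil_iff.1 hL
    have h2 := mt isNil_iff.1 hA
    have h3 : B.isNil = false := by
      by_contra hB
      exact h2 (hR.2.2 (by simpa using hB))
    simp only [Bool.not_eq_true] at h1 h2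
    simp only [Cls, h1, h2, h3, isNil_node]
    tauto

theorem rot_noLeftOnly {L : ITree} {m : ℕ} {R : ITree} (h : (node L m R).NoLeftOnly) :
    (rot L m R).NoLeftOnly := by
  rw [noLeftOnly_iff] at h ⊢
  intro y
  rw [rot_cls]
  · exact h y
  · exact (noLeftOnly_iff.2 h).2.1

theorem rot_incr {L : ITree} {m : ℕ} {R : ITree} {b : ℕ} (h : (node L m R).Incr b)
    (hr : R.root < L.root ∨ L = nil) : (rot L m R).Incr b := by
  refine rot_cases (motive := fun L m R t => (node L m R).Incr b → (R.root < L.root ∨ L = nil) →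
    t.Incr b) ?_ ?_ ?_ ?_ ?_ L m R h hr
  · intro m R h _; exact h
  · intro L m h _; exact h
  · intro L m y _ h _; exact ⟨h.1, ⟨h.2.2.1, trivial, trivial⟩, h.2.1⟩
  · intro L m y B hL hB h hr
    exact ⟨h.1, ⟨h.2.2.1, trivial, h.2.1.of_lt (hr.resolve_right hL)⟩, h.2.2.2.2.mono h.2.2.1.le⟩
  · intro L m A y B hL hA h hr
    exact ⟨h.1, ⟨h.2.2.1, h.2.1.of_lt (hr.resolve_right hL), h.2.2.2.1⟩,
      h.2.2.2.2.mono h.2.2.1.le⟩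

@[simp] theorem Phi_root (S : ℕ → Bool) (t : ITree) : (Phi S t).root = t.root := by
  cases t with
  | nil => rfl
  | node L m R =>
    rw [Phi]
    split_ifs
    · rw [rot_root]; rfl
    · rfl

theorem isNil_eq_of_root {s t : ITree} (h : s.root = t.root) : s.isNil = t.isNil := by
  cases s <;> cases t <;> simp_all [root, isNil]

@[simp] theorem Phi_isNil (S : ℕ → Bool) (t : ITree) : (Phi S t).isNil = t.isNil :=
  isNil_eq_of_root (Phi_root S t)

@[simp] theorem Phi_eq_nil {S : ℕ → Bool} {t : ITree} : Phi S t = nil ↔ t = nil := by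
  rw [← isNil_iff, Phi_isNil, isNil_iff]

theorem Phi_word_perm (S : ℕ → Bool) (t : ITree) : (Phi S t).word.Perm t.word := by
  induction t with
  | nil => rfl
  | node L m R ihL ihR =>
    rw [Phi]
    have : (node (Phi S L) m (Phi S R)).word.Perm (node L m R).word := by
      simp only [word]
      exact ihL.append (ihR.cons m)
    split_ifs
    · exact (rot_word_perm _ _ _).trans this
    · exact this

theorem Phi_noLeftOnly (S : ℕ → Bool) {t : ITree} (h : t.NoLeftOnly) :
    (Phi S t).NoLeftOnly := by
  induction t with
  | nil => trivial
  | node L m R ihL ihR =>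
    rw [Phi]
    have : (node (Phi S L) m (Phi S R)).NoLeftOnly :=
      ⟨ihL h.1, ihR h.2.1, by simpa using h.2.2⟩
    split_ifs
    · exact rot_noLeftOnly this
    · exact this

theorem Phi_cls (p : Bool → Bool → Prop) (S : ℕ → Bool) {t : ITree} (h : t.NoLeftOnly) (x : ℕ) :
    Cls p (Phi S t) x ↔ Cls p t x := by
  induction t with
  | nil => rfl
  | node L m R ihL ihR =>
    have : Cls p (node (Phi S L) m (Phi S R)) x ↔ Cls p (node L m R) x := by
      simp only [Cls, Phi_isNil, ihL h.1, ihR h.2.1]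
    rw [Phi]
    split_ifs
    · rw [rot_cls _ _ _ _ _ (Phi_noLeftOnly S h.2.1), this]
    · exact this

/-- In an André tree with distinct labels, right children are smaller than left children. -/
theorem Andre.root_lt {L R : ITree} {m : ℕ} (h : (node L m R).Andre)
    (hn : (node L m R).word.Nodup) : R.root < L.root ∨ L = nil := by
  by_cases hL : L = nil
  · exact Or.inr hL
  · exact Or.inl (lt_of_le_of_ne h.2.2
      (root_ne_of_disjoint (nodup_node hn).2.2.2.2 hL).symm)

theorem Phi_incr (S : ℕ → Bool) {t : ITree} : ∀ {b : ℕ}, t.Incr b → t.word.Nodup → t.Andre →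
    (Phi S t).Incr b := by
  induction t with
  | nil => intros; trivial
  | node L m R ihL ihR =>
    intro b h hn ha
    obtain ⟨nL, nR, -⟩ := nodup_node hn
    have : (node (Phi S L) m (Phi S R)).Incr b :=
      ⟨h.1, ihL h.2.1 nL ha.1, ihR h.2.2 nR ha.2.1⟩
    rw [Phi]
    split_ifs
    · exact rot_incr this (by simpa using ha.root_lt hn)
    · exact this

theorem Phi_congr {S S' : ℕ → Bool} {t : ITree} (h : ∀ x ∈ t.word, S x = S' x) :
    Phi S t = Phi S' t := by
  induction t with
  | nil => rfl
  | node L m R ihL ihR =>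
    simp only [word, List.mem_append, List.mem_cons] at h
    rw [Phi, Phi, h m (by simp), ihL fun x hx => h x (by simp [hx]),
      ihR fun x hx => h x (by simp [hx])]

/-! ### Inverting the transform -/

/-- The transform at the root exchanges the order of the two children. -/
theorem rot_root_lt {L R : ITree} {m b : ℕ} (hL : L ≠ nil) (h : (node L m R).Incr b)
    (hr : R.root < L.root) (hN : R.NoLeftOnly) :
    ∃ A B, rot L m R = node A m B ∧ A.root < B.root := by
  refine rot_cases (motive := fun L m R t => L ≠ nil → (node L m R).Incr b → R.root < L.root →
    R.NoLeftOnly → ∃ A B, t = node A m B ∧ A.root < B.root) ?_ ?_ ?_ ?_ ?_ L m R hL h hr hN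
  · intro m R h; exact absurd rfl h
  · intro L m _ _ h; simp [root] at h
  · intro L m y _ _ _ h _
    exact ⟨_, _, rfl, h⟩
  · intro L m y B _ _ _ h _ _
    refine ⟨_, _, rfl, ?_⟩
    exact (by assumption : (node L m (node nil y B)).Incr b).2.2.2.2.root_gt
  · intro L m A y B _ _ _ h _ _
    refine ⟨_, _, rfl, ?_⟩
    exact (by assumption : (node L m (node A y B)).Incr b).2.2.2.2.root_gt

/-- The left child of the result is `y`, and its type (leaf, right child only, two children) reveals
which case of `rot` was applied; within a case all the pieces can be read off. -/
theorem rot_injective {L R L' R' : ITree} {m m' : ℕ} (hL : L ≠ nil) (hR : R ≠ nil)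
    (hL' : L' ≠ nil) (hR' : R' ≠ nil) (hN : R.NoLeftOnly) (hN' : R'.NoLeftOnly)
    (h : rot L m R = rot L' m' R') : L = L' ∧ m = m' ∧ R = R' := by
  cases R with
  | nil => exact absurd rfl hR
  | node A y B =>
  cases R' with
  | nil => exact absurd rfl hR'
  | node A' y' B' =>
  by_cases hA : A = nil <;> by_cases hA' : A' = nil
  · subst hA hA'
    by_cases hB : B = nil <;> by_cases hB' : B' = nil
    · subst hB hB'
      rw [rot_leaf _ _ hL, rot_leaf _ _ hL'] at h
      simp at h; simp [h]
    · subst hB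
      rw [rot_leaf _ _ hL, rot_chain _ _ hL' hB'] at h
      simp at h
      exact absurd h.1.2.symm hL'
    · subst hB'
      rw [rot_chain _ _ hL hB, rot_leaf _ _ hL'] at h
      simp at h
      exact absurd h.1.2 hL
    · rw [rot_chain _ _ hL hB, rot_chain _ _ hL' hB'] at h
      simp at h; simp [h]
  · subst hA
    rw [rot_binary _ _ _ hL' hA'] at h
    by_cases hB : B = nil
    · subst hB
      rw [rot_leaf _ _ hL] at h
      simp at h
      exact absurd h.1.1.symm hL'
    · rw [rot_chain _ _ hL hB] at h
      simp at h
      exact absurd h.1.1.symm hL'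
  · subst hA'
    rw [rot_binary _ _ _ hL hA] at h
    by_cases hB : B' = nil
    · subst hB
      rw [rot_leaf _ _ hL'] at h
      simp at h
      exact absurd h.1.1 hL
    · rw [rot_chain _ _ hL' hB] at h
      simp at h
      exact absurd h.1.1 hL
  · rw [rot_binary _ _ _ hL hA, rot_binary _ _ _ hL' hA'] at h
    simp at h; simp [h]

/-- Every increasing tree whose left child is smaller than its right child comes from a transform
at the root. -/
theorem exists_rot_eq {L R : ITree} {m b : ℕ} (h : (node L m R).Incr b)
    (hN : (node L m R).NoLeftOnly) (hr : L.root < R.root) (hRn : R ≠ nil) :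
    ∃ L' R', rot L' m R' = node L m R ∧ L' ≠ nil ∧ R'.root < L'.root ∧ (node L' m R').Incr b ∧
      L'.NoLeftOnly ∧ R'.NoLeftOnly ∧ (node L' m R').word.Perm (node L m R).word := by
  have key : ∀ L' R', rot L' m R' = node L m R → L' ≠ nil → R'.root < L'.root →
      (node L' m R').Incr b → L'.NoLeftOnly → R'.NoLeftOnly → _ := fun L' R' h1 h2 h3 h4 h5 h6 =>
    (⟨L', R', h1, h2, h3, h4, h5, h6, by rw [← h1]; exact (rot_word_perm _ _ _).symm⟩ :
    ∃ L' R', rot L' m R' = node L m R ∧ L' ≠ nil ∧ R'.root < L'.root ∧ (node L' m R').Incr b ∧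
      L'.NoLeftOnly ∧ R'.NoLeftOnly ∧ (node L' m R').word.Perm (node L m R).word)
  cases L with
  | nil => simp [root] at hr
  | node C y D =>
    obtain ⟨h0, ⟨hy, hC, hD⟩, hR⟩ := h
    obtain ⟨⟨nC, nD, nCD⟩, nR, -⟩ := hN
    -- The type of the left root `y` selects the case of `rot` to undo. In the last two cases the
    -- new left subtree is a child of `y`, so its root exceeds `y`.
    by_cases hCn : C = nil
    · subst hCn
      by_cases hDn : D = nil
      · subst hDn
        exact key R (node nil y nil) (rot_leaf _ _ hRn) hRn hr ⟨h0, hR, hy, hC, hD⟩ nR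
          ⟨nC, nD, nCD⟩
      · exact key D (node nil y R) (rot_chain _ _ hDn hRn) hDn hD.root_gt
          ⟨h0, hD.mono hy.le, hy, trivial, hR.of_lt hr⟩ nD ⟨nC, nR, fun _ => rfl⟩
    · have hDn : D ≠ nil := fun hD => hCn (isNil_iff.1 (nCD (isNil_iff.2 hD)))
      exact key C (node D y R) (rot_binary _ _ _ hCn hDn) hCn hC.root_gt
        ⟨h0, hC.mono hy.le, hy, hD, hR.of_lt hr⟩ nC
        ⟨nD, nR, fun h => absurd (isNil_iff.1 h) hRn⟩

theorem length_word_pos {L R : ITree} {m : ℕ} :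
    L.word.length < (node L m R).word.length ∧ R.word.length < (node L m R).word.length := by
  simp [word]; omega

/-- Every increasing tree without left-only nodes is the transform of an André tree. -/
theorem exists_Phi_eq : ∀ (k : ℕ) {u : ITree} {b : ℕ}, u.word.length ≤ k → u.Incr b →
    u.word.Nodup → u.NoLeftOnly → ∃ (t : ITree) (S : ℕ → Bool), t.Incr b ∧ t.Andre ∧
      Phi S t = u := by
  intro k
  induction k with
  | zero =>
    intro u b hk _ _ _
    have : u = nil := by simpa using hk
    exact ⟨nil, fun _ => false, trivial, trivial, this.symm⟩
  | succ k ih =>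
    intro u b hk h hn hN
    -- The induction is on the number of letters because undoing `rot` yields subtrees that need not
    -- be subtrees of `u`. The Boolean `c` records whether the root is to be transformed.
    have main : ∀ (L R : ITree) (m : ℕ) (c : Bool), (node L m R).Incr b →
        (node L m R).word.Nodup → L.NoLeftOnly → R.NoLeftOnly → R.root ≤ L.root →
        (node L m R).word.length ≤ k + 1 →
        ∃ (t : ITree) (S : ℕ → Bool), t.Incr b ∧ t.Andre ∧
          Phi S t = if c then rot L m R else node L m R := by
      intro L R m c h hn hNL hNR hr hk
      obtain ⟨nL, nR, h1, h2, h3⟩ := nodup_node hn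
      have hl := length_word_pos (L := L) (R := R) (m := m)
      obtain ⟨L', S, hL, aL, eL⟩ := ih (by omega) h.2.1 nL hNL
      obtain ⟨R', S', hR, aR, eR⟩ := ih (by omega) h.2.2 nR hNR
      have rL : L'.root = L.root := by rw [← eL, Phi_root]
      have rR : R'.root = R.root := by rw [← eR, Phi_root]
      have pL := Phi_word_perm S L'
      have pR := Phi_word_perm S' R'
      rw [eL] at pL
      rw [eR] at pR
      -- The two subtrees and the root have disjoint labels, so the choices made on each can be
      -- glued.
      set T : ℕ → Bool := fun x => if x = m then c else if x ∈ L.word then S x else S' x with hT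
      have e1 : Phi T L' = L := by
        rw [← eL]
        refine Phi_congr fun x hx => ?_
        have hx' := pL.mem_iff.2 hx
        have hxm : x ≠ m := fun h => h1 (h ▸ hx')
        simp [hT, hxm, hx']
      have e2 : Phi T R' = R := by
        rw [← eR]
        refine Phi_congr fun x hx => ?_
        have hx' := pR.mem_iff.2 hx
        have hxm : x ≠ m := fun h => h2 (h ▸ hx')
        have hxL : x ∉ L.word := fun h => h3 x h hx'
        simp [hT, hxm, hxL]
      refine ⟨node L' m R', T, ⟨h.1, hL, hR⟩, ⟨aL, aR, by rw [rL, rR]; exact hr⟩, ?_⟩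
      rw [Phi, e1, e2]
      simp [hT]
    cases u with
    | nil => exact ⟨nil, fun _ => false, trivial, trivial, rfl⟩
    | node L m R =>
      rcases le_or_gt R.root L.root with hr | hr
      · simpa using main L R m false h hn hN.1 hN.2.1 hr hk
      · by_cases hRn : R = nil
        · have hL := isNil_iff.1 (hN.2.2 (isNil_iff.2 hRn))
          rw [hRn, hL] at hr
          exact absurd hr (lt_irrefl _)
        obtain ⟨L', R', e, -, hr', h', nL', nR', hp⟩ := exists_rot_eq h hN hr hRn
        have := main L' R' m true h' (hp.nodup_iff.2 hn) nL' nR' hr'.le (by rw [hp.length_eq]; exact hk)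
        rw [← e]
        simpa using this

/-- `rot` does nothing when the left subtree is empty, so a selected label without left child falls
under the untransformed case. -/
theorem Phi_node_cases (S : ℕ → Bool) (L : ITree) (m : ℕ) (R : ITree) :
    (Phi S (node L m R) = node (Phi S L) m (Phi S R) ∧ (L ≠ nil → S m = false)) ∨
    (Phi S (node L m R) = rot (Phi S L) m (Phi S R) ∧ L ≠ nil ∧ S m = true) := by
  by_cases hL : L = nil
  · left; subst hL; simp [Phi]
  · cases hS : S m
    · left; simp [Phi, hS]
    · right; simp [Phi, hS, hL]

/-- An André tree and the set of transformed nodes are determined by the transformed tree. -/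
theorem Phi_injective {S S' : ℕ → Bool} {t : ITree} : ∀ {t' : ITree} {b b' : ℕ}, t.Incr b →
    t'.Incr b' → t.word.Nodup → t'.word.Nodup → t.Andre → t'.Andre → Phi S t = Phi S' t' →
    t = t' ∧ ∀ x, Cls (fun l r => l = false ∧ r = false) t x → S x = S' x := by
  induction t with
  | nil =>
    intro t' b b' _ _ _ _ _ _ h
    exact ⟨(Phi_eq_nil.1 (show Phi S' t' = nil from h.symm)).symm, by simp [Cls]⟩
  | node L m R ihL ihR =>
    intro t' b b' h h' hn hn' ha ha' he
    have hroot : (node L m R).root = t'.root := by rw [← Phi_root S, he, Phi_root]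
    cases t' with
    | nil => simp [root] at hroot
    | node L' m' R' =>
      have hm : m = m' := by simpa [root] using hroot
      subst hm
      have fin : Phi S L = Phi S' L' → Phi S R = Phi S' R' → (L ≠ nil → L' ≠ nil → S m = S' m) →
          node L m R = node L' m R' ∧
          ∀ x, Cls (fun l r => l = false ∧ r = false) (node L m R) x → S x = S' x := by
        intro e1 e2 e3
        obtain ⟨rfl, c1⟩ := ihL h.2.1 h'.2.1 (nodup_node hn).1 (nodup_node hn').1 ha.1 ha'.1 e1
        obtain ⟨rfl, c2⟩ := ihR h.2.2 h'.2.2 (nodup_node hn).2.1 (nodup_node hn').2.1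
          ha.2.1 ha'.2.1 e2
        refine ⟨rfl, ?_⟩
        rintro x (⟨rfl, hx, -⟩ | hx | hx)
        · have : L ≠ nil := fun hc => by simp [hc] at hx
          exact e3 this this
        · exact c1 x hx
        · exact c2 x hx
      have lt_of_rot : ∀ (S : ℕ → Bool) {L R : ITree} {b : ℕ}, (node L m R).Incr b →
          (node L m R).word.Nodup → (node L m R).Andre → L ≠ nil →
          ∃ A B, rot (Phi S L) m (Phi S R) = node A m B ∧ A.root < B.root := by
        intro S L R b h hn ha hL
        exact rot_root_lt (b := b) (by simpa using hL)
          ⟨h.1, Phi_incr S h.2.1 (nodup_node hn).1 ha.1, Phi_incr S h.2.2 (nodup_node hn).2.1 ha.2.1⟩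
          (by simpa using (ha.root_lt hn).resolve_right hL) (Phi_noLeftOnly S ha.2.1.noLeftOnly)
      have right_ne : ∀ {L R : ITree}, (node L m R).Andre → L ≠ nil → R ≠ nil := by
        rintro L R ha hL rfl
        exact hL (isNil_iff.1 (ha.noLeftOnly.2.2 rfl))
      -- In the two mixed cases the root is transformed on one side only. The left child of the
      -- result would be strictly smaller than the right one, against the André order of the
      -- untransformed side.
      rcases Phi_node_cases S L m R with ⟨e, c⟩ | ⟨e, hL, c⟩ <;>
        rcases Phi_node_cases S' L' m R' with ⟨e', c'⟩ | ⟨e', hL', c'⟩ <;> rw [e, e'] at he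
      · simp only [node.injEq, true_and] at he
        exact fin he.1 he.2 fun h1 h2 => by rw [c h1, c' h2]
      · obtain ⟨A, B, e1, hlt⟩ := lt_of_rot S' h' hn' ha' hL'
        rw [e1] at he
        simp only [node.injEq, true_and] at he
        rw [← he.1, ← he.2, Phi_root, Phi_root] at hlt
        exact absurd hlt (not_lt.2 ha.2.2)
      · obtain ⟨A, B, e1, hlt⟩ := lt_of_rot S h hn ha hL
        rw [e1] at he
        simp only [node.injEq, true_and] at he
        rw [he.1, he.2, Phi_root, Phi_root] at hlt
        exact absurd hlt (not_lt.2 ha'.2.2)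
      · obtain ⟨e1, -, e2⟩ := rot_injective (by simpa using hL) (by simpa using right_ne ha hL)
          (by simpa using hL') (by simpa using right_ne ha' hL')
          (Phi_noLeftOnly S ha.2.1.noLeftOnly) (Phi_noLeftOnly S' ha'.2.1.noLeftOnly) he
        exact fin e1 e2 fun _ _ => by rw [c, c']

end ITree

/-! ### The `x`-factorization of a word -/

section Factorization

variable {P A B Q : List ℕ} {x : ℕ}

theorem takeWhile_ne_eq {u v : List ℕ} (hu : x ∉ u) :
    (u ++ x :: v).takeWhile (fun a => a ≠ x) = u := by
  rw [List.takeWhile_append_of_pos]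
  · simp
  · intro a ha
    have : a ≠ x := fun h => hu (h ▸ ha)
    simpa using this

theorem dropWhile_ne_eq {u v : List ℕ} (hu : x ∉ u) :
    (u ++ x :: v).dropWhile (fun a => a ≠ x) = x :: v := by
  rw [List.dropWhile_append_of_pos]
  · simp
  · intro a ha
    have : a ≠ x := fun h => hu (h ▸ ha)
    simpa using this

/-- The default value `0` treats the end of the word as a letter below `x`, in accordance with the
convention on `σₙ₊₁`. -/
theorem takeWhile_lt_eq (hB : ∀ a ∈ B, x < a) (hQ : Q.headD 0 < x) :
    (B ++ Q).takeWhile (fun a => x < a) = B := by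
  rw [List.takeWhile_append_of_pos (by simpa using hB)]
  cases Q with
  | nil => simp
  | cons c Q =>
    have : ¬ x < c := by simpa using hQ.le
    simp [this]

theorem dropWhile_lt_eq (hB : ∀ a ∈ B, x < a) (hQ : Q.headD 0 < x) :
    (B ++ Q).dropWhile (fun a => x < a) = Q := by
  rw [List.dropWhile_append_of_pos (by simpa using hB)]
  cases Q with
  | nil => simp
  | cons c Q =>
    have : ¬ x < c := by simpa using hQ.le
    simp [this]

theorem getLastD_append_cons (u v : List ℕ) (m : ℕ) : ∀ l : ℕ,
    (u ++ m :: v).getLastD l = v.getLastD m := by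
  induction u with
  | nil => intro l; simp only [List.nil_append, List.getLastD_cons]
  | cons a u ih => intro l; rw [List.cons_append, List.getLastD_cons, ih]

theorem headD_reverse (P : List ℕ) (l : ℕ) : P.reverse.headD l = P.getLastD l := by
  rw [List.headD_eq_head?_getD, List.head?_reverse, List.getLastD_eq_getLast?]

theorem w1_eq (hA : ∀ a ∈ A, x < a) (hP : P.getLastD 0 < x) (hx : x ∉ P) :
    w1 (P ++ A ++ x :: (B ++ Q)) x = P := by
  have hx' : x ∉ P ++ A := by simpa [hx] using fun h => lt_irrefl _ (hA x h)
  rw [w1, takeWhile_ne_eq hx', List.rdropWhile, List.reverse_append,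
    dropWhile_lt_eq (by simpa using hA) (by rwa [headD_reverse]), List.reverse_reverse]

theorem w2_eq (hA : ∀ a ∈ A, x < a) (hP : P.getLastD 0 < x) (hx : x ∉ P) :
    w2 (P ++ A ++ x :: (B ++ Q)) x = A := by
  have hx' : x ∉ P ++ A := by simpa [hx] using fun h => lt_irrefl _ (hA x h)
  rw [w2, takeWhile_ne_eq hx', List.rtakeWhile, List.reverse_append,
    takeWhile_lt_eq (by simpa using hA) (by rwa [headD_reverse]), List.reverse_reverse]

theorem w4_eq (hA : ∀ a ∈ A, x < a) (hB : ∀ a ∈ B, x < a) (hQ : Q.headD 0 < x) (hx : x ∉ P) :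
    w4 (P ++ A ++ x :: (B ++ Q)) x = B := by
  have hx' : x ∉ P ++ A := by simpa [hx] using fun h => lt_irrefl _ (hA x h)
  rw [w4, dropWhile_ne_eq hx', List.tail_cons, takeWhile_lt_eq hB hQ]

theorem w5_eq (hA : ∀ a ∈ A, x < a) (hB : ∀ a ∈ B, x < a) (hQ : Q.headD 0 < x) (hx : x ∉ P) :
    w5 (P ++ A ++ x :: (B ++ Q)) x = Q := by
  have hx' : x ∉ P ++ A := by simpa [hx] using fun h => lt_irrefl _ (hA x h)
  rw [w5, dropWhile_ne_eq hx', List.tail_cons, dropWhile_lt_eq hB hQ]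

end Factorization

/-! ### The word transform as an operation on trees -/

namespace ITree

theorem Incr.minLetter_word {A B : ITree} {y b : ℕ} (h : (node A y B).Incr b) :
    minLetter (node A y B).word = y := by
  have : (node A y B).word.min? = some y := by
    rw [List.min?_eq_some_iff]
    refine ⟨by simp [word], fun a ha => ?_⟩
    simp only [word, List.mem_append, List.mem_cons] at ha
    rcases ha with ha | rfl | ha
    exacts [(h.2.1.lt a ha).le, le_rfl, (h.2.2.lt a ha).le]
  simp [minLetter, this]

theorem op_of_notMem {t : ITree} {x : ℕ} (hx : x ∉ t.word) : op t x = t := by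
  induction t with
  | nil => rfl
  | node L m R ihL ihR =>
    simp only [word, List.mem_append, List.mem_cons, not_or] at hx
    rw [op, if_neg (fun h => hx.2.1 h.symm), ihL hx.1, ihR hx.2.2]

theorem op_root (t : ITree) (x : ℕ) : (op t x).root = t.root := by
  cases t with
  | nil => rfl
  | node L m R =>
    rw [op]
    split_ifs
    · rw [rot_root]; rfl
    · rfl

theorem op_eq_nil {t : ITree} {x : ℕ} : op t x = nil ↔ t = nil := by
  rw [← root_eq_top, op_root, root_eq_top]

theorem op_word_perm (t : ITree) (x : ℕ) : (op t x).word.Perm t.word := by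
  induction t with
  | nil => rfl
  | node L m R ihL ihR =>
    rw [op]
    split_ifs
    · exact rot_word_perm _ _ _
    · simp only [word]; exact ihL.append (ihR.cons m)

theorem foldl_op_word_perm (l : List ℕ) : ∀ t : ITree, (l.foldl op t).word.Perm t.word := by
  induction l with
  | nil => intro t; rfl
  | cons x l ih => intro t; exact (ih _).trans (op_word_perm t x)

/-- The words of a tree and of its transform at `x`, around the subtree with root `x`. -/
theorem Sub.exists_factor {t A B : ITree} {x : ℕ} (h : Sub (node A x B) t) :
    ∀ {b l r : ℕ}, t.Incr b → t.word.Nodup → l ≤ b → r ≤ b →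
    (node A x B).Incr b ∧ ∃ P Q : List ℕ, t.word = P ++ A.word ++ x :: (B.word ++ Q) ∧
      (op t x).word = P ++ (rot A x B).word ++ Q ∧ P.getLastD l < x ∧ Q.headD r < x ∧ x ∉ P := by
  induction t with
  | nil => exact h.elim
  | node L m R ihL ihR =>
    intro b l r hi hn hl hr
    obtain ⟨nL, nR, h1, h2, h3⟩ := nodup_node hn
    have hlm := hl.trans_lt hi.1
    have hrm := hr.trans_lt hi.1
    rcases h with h | h | h
    · cases h
      exact ⟨hi, [], [], by simp [word], by simp [op], hlm, hrm, by simp⟩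
    · have hx := h.mem_word
      obtain ⟨hs, P, Q, e1, e2, hP, hQ, hxP⟩ := ihL h hi.2.1 nL hlm.le le_rfl
      refine ⟨hs.mono hi.1.le, P, Q ++ m :: R.word, by simp [word, e1], ?_, hP, ?_, hxP⟩
      · have hne : m ≠ x := fun h => h1 (h ▸ hx)
        rw [op, if_neg hne, op_of_notMem (h3 x hx), word, e2]
        simp
      · cases Q with
        | nil => exact hi.2.1.lt x hx
        | cons c Q => exact hQ
    · have hx := h.mem_word
      obtain ⟨hs, P, Q, e1, e2, hP, hQ, hxP⟩ := ihR h hi.2.2 nR le_rfl hrm.le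
      refine ⟨hs.mono hi.1.le, L.word ++ m :: P, Q, by simp [word, e1], ?_, ?_, hQ, ?_⟩
      · have hne : m ≠ x := fun h => h2 (h ▸ hx)
        rw [op, if_neg hne, op_of_notMem (fun hc => h3 x hc hx), word, e2]
        simp
      · rwa [getLastD_append_cons]
      · simp only [List.mem_append, List.mem_cons, not_or]
        exact ⟨fun hc => h3 x hc hx, fun hc => h2 (hc ▸ hx), hxP⟩

/-- The two children of a node at which the transform may be applied. -/
def Movable (A B : ITree) : Prop :=
  A ≠ nil ∧ B.root < A.root ∧ B.NoLeftOnly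

/-- The factors `w2` and `w4` are the words of the two subtrees at `x`, whose minima are their
roots; the right root is the smaller by hypothesis. -/
theorem min_y1_y2_word {t A C D : ITree} {x y : ℕ} (hi : t.Incr 0) (hn : t.word.Nodup)
    (h : Sub (node A x (node C y D)) t) (hA : A ≠ nil) (hlt : (node C y D).root < A.root) :
    min (y1 t.word x) (y2 t.word x) = y ∧ y2 t.word x = y := by
  obtain ⟨hs, P, Q, e1, -, hP, hQ, hx⟩ := h.exists_factor hi hn le_rfl le_rfl
  have a1 := hs.2.1.lt
  have a2 := hs.2.2.lt
  have hy2 : y2 t.word x = y := by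
    rw [y2, e1, w4_eq a1 a2 hQ hx, hs.2.2.minLetter_word]
  refine ⟨?_, hy2⟩
  rw [hy2, y1, e1, w2_eq a1 hP hx]
  cases A with
  | nil => exact absurd rfl hA
  | node E z F =>
    rw [hs.2.1.minLetter_word]
    have : y < z := by simpa [root] using hlt
    omega

/-- Since `y` is the root of the right subtree, only the branches with `y = y2` occur, and the peak,
double ascent and valley cases are the three nontrivial cases of `rot`. In the valley case `w'` and
`w''` are the words of the children of `y`. -/
theorem transform_word {t A B : ITree} {x : ℕ} (hi : t.Incr 0) (hn : t.word.Nodup)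
    (h : Sub (node A x B) t) (hm : Movable A B) : transform t.word x = (op t x).word := by
  obtain ⟨hA, hlt, hN⟩ := hm
  cases B with
  | nil => simp [root] at hlt
  | node C y D =>
    obtain ⟨hy, hy2⟩ := min_y1_y2_word hi hn h hA hlt
    obtain ⟨hs, P, Q, e1, e2, hP, hQ, hx⟩ := h.exists_factor hi hn le_rfl le_rfl
    have a1 := hs.2.1.lt
    have a2 := hs.2.2.lt
    have f1 : w1 t.word x = P := by rw [e1, w1_eq a1 hP hx]
    have f2 : w2 t.word x = A.word := by rw [e1, w2_eq a1 hP hx]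
    have f4 : w4 t.word x = (node C y D).word := by rw [e1, w4_eq a1 a2 hQ hx]
    have f5 : w5 t.word x = Q := by rw [e1, w5_eq a1 a2 hQ hx]
    have hsub := h.right
    have c1 : y ∈ peaks t.word ↔ _ := (mem_peaks_word hi y).trans (cls_of_sub hn hsub)
    have c2 : y ∈ doubleAscents t.word ↔ _ :=
      (mem_doubleAscents_word hi y).trans (cls_of_sub hn hsub)
    have c3 : y ∈ valleys t.word ↔ _ := (mem_valleys_word hi y).trans (cls_of_sub hn hsub)
    rw [e2]
    unfold transform
    simp only [hy]
    simp only [hy2, if_true, f1, f2, f4, f5]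
    by_cases hC : C = nil
    · subst hC
      by_cases hD : D = nil
      · subst hD
        rw [if_pos (c1.2 ⟨rfl, rfl⟩), rot_leaf _ _ hA]
        simp [word]
      · have hD' : D.isNil = false := by simpa using mt isNil_iff.1 hD
        rw [if_neg (by rw [c1]; simp [hD']), if_pos (c2.2 ⟨rfl, hD'⟩), rot_chain _ _ hA hD]
        simp [word]
    · have hC' : C.isNil = false := by simpa using mt isNil_iff.1 hC
      have hD' : D.isNil = false := by
        by_contra hD
        simp [hN.2.2 (by simpa using hD)] at hC'
      rw [if_neg (by rw [c1]; simp [hD']), if_neg (by rw [c2]; simp [hC']),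
        if_pos (c3.2 ⟨hC', hD'⟩), rot_binary _ _ _ hA hC]
      have hyC : y ∉ C.word := fun hc => lt_irrefl _ (hs.2.2.2.1.lt y hc)
      simp only [word]
      rw [takeWhile_ne_eq hyC, dropWhile_ne_eq hyC]
      simp

/-! ### The order of the transforms -/

/-- In the list `l`, no letter is followed by the root of the right subtree at that letter. -/
def Admissible (l : List ℕ) (t : ITree) : Prop :=
  ∀ A x C y D, Sub (node A x (node C y D)) t → ∀ l1 l2, l = l1 ++ x :: l2 → y ∉ l2

theorem Admissible.left {l : List ℕ} {L R : ITree} {m : ℕ} (h : Admissible l (node L m R)) :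
    Admissible l L := fun A x C y D hs => h A x C y D (Or.inr (Or.inl hs))

theorem Admissible.right {l : List ℕ} {L R : ITree} {m : ℕ} (h : Admissible l (node L m R)) :
    Admissible l R := fun A x C y D hs => h A x C y D (Or.inr (Or.inr hs))

theorem Admissible.prefix {l l' : List ℕ} {t : ITree} (h : Admissible (l ++ l') t) :
    Admissible l t := by
  intro A x C y D hs l1 l2 e hy
  exact h A x C y D hs l1 (l2 ++ l') (by simp [e]) (by simp [hy])

/-- `rot` changes only the children of `m` and of the right root `y`; a transform at another letter
acts inside a subtree that is moved as a whole. It also keeps empty trees empty and nonempty trees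
nonempty, so the same case of `rot` applies afterwards. -/
theorem op_rot {L R : ITree} {m z : ℕ} (hm : z ≠ m) (hR : ∀ C y D, R = node C y D → z ≠ y) :
    op (rot L m R) z = rot (op L z) m (op R z) := by
  refine rot_cases (motive := fun L m R t => z ≠ m → (∀ C y D, R = node C y D → z ≠ y) →
    op t z = rot (op L z) m (op R z)) ?_ ?_ ?_ ?_ ?_ L m R hm hR
  · intro m R hm _; simp [op, hm.symm]
  · intro L m hm _; simp [op, hm.symm]
  · intro L m y hL hm hy
    have hy := (hy _ _ _ rfl).symm
    simp only [op, hm.symm, hy, if_false]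
    rw [rot_leaf _ _ (mt op_eq_nil.1 hL)]
  · intro L m y B hL hB hm hy
    have hy := (hy _ _ _ rfl).symm
    simp only [op, hm.symm, hy, if_false]
    rw [rot_chain _ _ (mt op_eq_nil.1 hL) (mt op_eq_nil.1 hB)]
  · intro L m A y B hL hA hm hy
    have hy := (hy _ _ _ rfl).symm
    simp only [op, hm.symm, hy, if_false]
    rw [rot_binary _ _ _ (mt op_eq_nil.1 hL) (mt op_eq_nil.1 hA)]

theorem foldl_op_node {l : List ℕ} {m : ℕ} (hm : m ∉ l) : ∀ {L R : ITree},
    l.foldl op (node L m R) = node (l.foldl op L) m (l.foldl op R) := by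
  induction l with
  | nil => intros; rfl
  | cons z l ih =>
    intro L R
    simp only [List.mem_cons, not_or] at hm
    simp only [List.foldl_cons]
    rw [op, if_neg hm.1, ih hm.2]

theorem foldl_op_rot {l : List ℕ} {m : ℕ} (hm : m ∉ l) : ∀ {L R : ITree},
    (∀ y : ℕ, R.root = y → y ∉ l) →
    l.foldl op (rot L m R) = rot (l.foldl op L) m (l.foldl op R) := by
  induction l with
  | nil => intros; rfl
  | cons z l ih =>
    intro L R hR
    simp only [List.mem_cons, not_or] at hm
    simp only [List.foldl_cons]
    rw [op_rot (fun h => hm.1 h.symm), ih hm.2]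
    · intro y hy
      rw [op_root] at hy
      exact fun h => hR y hy (by simp [h])
    · rintro C y D rfl rfl
      exact hR z rfl (by simp)

theorem foldl_op_root (l : List ℕ) : ∀ t : ITree, (l.foldl op t).root = t.root := by
  induction l with
  | nil => intro t; rfl
  | cons x l ih => intro t; rw [List.foldl_cons, ih, op_root]

/-- Transforms at the letters of an admissible list amount to the recursive transform. -/
theorem foldl_op_eq_Phi {l : List ℕ} {t : ITree} (hl : l.Nodup) (hn : t.word.Nodup)
    (ha : Admissible l t) : l.foldl op t = Phi (fun x => decide (x ∈ l)) t := by
  induction t with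
  | nil =>
    rw [Phi, ← root_eq_top, foldl_op_root]; rfl
  | node L m R ihL ihR =>
    obtain ⟨nL, nR, h1, h2, h3⟩ := nodup_node hn
    rw [Phi, ← ihL nL ha.left, ← ihR nR ha.right]
    by_cases hm : m ∈ l
    · simp only [hm, decide_true, if_true]
      obtain ⟨l1, l2, rfl⟩ := List.append_of_mem hm
      have hd := List.nodup_append.1 hl
      have m1 : m ∉ l1 := fun h => hd.2.2 m h m (by simp) rfl
      have m2 : m ∉ l2 := (List.nodup_cons.1 hd.2.1).1
      simp only [List.foldl_append, List.foldl_cons]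
      -- The letters before `m` act inside its two subtrees. The later ones avoid `m` and, by
      -- admissibility, the right root, so they commute with `rot` at `m`.
      rw [foldl_op_node m1, op, if_pos rfl, foldl_op_rot m2,
        op_of_notMem (t := l1.foldl op L), op_of_notMem (t := l1.foldl op R)]
      · rwa [(foldl_op_word_perm l1 R).mem_iff]
      · rwa [(foldl_op_word_perm l1 L).mem_iff]
      · intro y hy
        rw [foldl_op_root] at hy
        cases R with
        | nil => simp [root] at hy
        | node C y' D =>
          have : y' = y := by simpa [root] using hy
          subst this
          exact ha L m C y' D (Or.inl rfl) l1 l2 rfl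
    · simp only [hm, decide_false, Bool.false_eq_true, if_false]
      rw [foldl_op_node hm]

/-- At a letter that has not been treated yet, the transform is applicable. -/
theorem Movable.of_sub_Phi {S : ℕ → Bool} {t : ITree} {x : ℕ} (hn : t.word.Nodup) (ha : t.Andre)
    (hS : S x = false) (hx : Cls (fun l r => l = false ∧ r = false) t x)
    (had : ∀ A m C D, Sub (node A m (node C x D)) t → S m = false) :
    ∀ A B, Sub (node A x B) (Phi S t) → Movable A B := by
  induction t with
  | nil => exact hx.elim
  | node L m R ihL ihR =>
    intro A B hs
    obtain ⟨nL, nR, h1, h2, h3⟩ := nodup_node hn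
    have hmem : ∀ t : ITree, x ∉ t.word → ¬ Sub (node A x B) (Phi S t) := fun t ht hs =>
      ht ((Phi_word_perm S t).mem_iff.1 hs.mem_word)
    have iL : Sub (node A x B) (Phi S L) → Movable A B := by
      intro h
      have hxL : x ∈ L.word := by by_contra hc; exact hmem L hc h
      refine ihL nL ha.1 ?_ (fun A m C D hs => had A m C D (Or.inr (Or.inl hs))) A B h
      rcases hx with ⟨rfl, -⟩ | hx | hx
      · exact absurd hxL h1
      · exact hx
      · exact absurd hx.mem_word (h3 x hxL)
    have iR : Sub (node A x B) (Phi S R) → Movable A B := by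
      intro h
      have hxR : x ∈ R.word := by by_contra hc; exact hmem R hc h
      refine ihR nR ha.2.1 ?_ (fun A m C D hs => had A m C D (Or.inr (Or.inr hs))) A B h
      rcases hx with ⟨rfl, -⟩ | hx | hx
      · exact absurd hxR h2
      · exact absurd hxR (h3 x hx.mem_word)
      · exact hx
    rw [Phi] at hs
    split_ifs at hs with hSm
    · have hxm : x ≠ m := by rintro rfl; simp [hSm] at hS
      have hxy : ∀ C y D, Phi S R = node C y D → x ≠ y := by
        rintro C y D hR rfl
        cases R with
        | nil => simp [Phi] at hR
        | node C' y' D' =>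
          have hr := Phi_root S (node C' y' D')
          rw [hR] at hr
          have : x = y' := by simpa [root] using hr
          subst this
          have := had L m C' D' (Or.inl rfl)
          simp [hSm] at this
      -- A node of the rotated tree other than `m` and `y` is a node of one of the two old subtrees,
      -- with the same children.
      have key : Sub (node A x B) (Phi S L) ∨ Sub (node A x B) (Phi S R) := by
        revert hxy hs
        refine rot_cases (motive := fun L m R t => x ≠ m → Sub (node A x B) t →
          (∀ C y D, R = node C y D → x ≠ y) → Sub (node A x B) L ∨ Sub (node A x B) R)
          ?_ ?_ ?_ ?_ ?_ _ _ _ hxm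
        all_goals
          intros
          simp_all [Sub]
          try tauto
      rcases key with h | h
      exacts [iL h, iR h]
    · rcases hs with hs | hs | hs
      · simp only [node.injEq] at hs
        obtain ⟨rfl, rfl, rfl⟩ := hs
        have hL : L ≠ nil := by
          rcases hx with ⟨-, hx, -⟩ | hx | hx
          · rintro rfl; simp at hx
          · exact absurd hx.mem_word h1
          · exact absurd hx.mem_word h2
        exact ⟨by simpa using hL, by simpa using (ha.root_lt hn).resolve_right hL,
          Phi_noLeftOnly S ha.2.1.noLeftOnly⟩
      · exact iL hs
      · exact iR hs

/-- Transforms of a word at an admissible list of valleys. -/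
theorem transformList_word {t : ITree} (hi : t.Incr 0) (hn : t.word.Nodup) (ha : t.Andre)
    {l : List ℕ} (hl : l.Nodup) (hv : ∀ x ∈ l, x ∈ valleys t.word) (had : Admissible l t) :
    transformList t.word l = (Phi (fun x => decide (x ∈ l)) t).word := by
  -- Induction on the last letter `x` treated: all earlier transforms are already expressed by
  -- `Phi`, and it remains to see that `x` is still movable.
  induction l using List.reverseRecOn with
  | nil =>
    have : Phi (fun x => decide (x ∈ ([] : List ℕ))) t = t := by
      rw [← foldl_op_eq_Phi (by simp) hn had]; rfl
    rw [this]; rfl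
  | append_singleton l x ih =>
    have hl' := List.nodup_append.1 hl
    have hxl : x ∉ l := fun h => hl'.2.2 x h x (by simp) rfl
    have e := ih hl'.1 (fun z hz => hv z (by simp [hz])) had.prefix
    have e2 := foldl_op_eq_Phi hl'.1 hn had.prefix
    rw [← foldl_op_eq_Phi hl hn had, List.foldl_append, e2]
    unfold transformList at e ⊢
    rw [List.foldl_append, e]
    simp only [List.foldl_cons, List.foldl_nil]
    set u := Phi (fun z => decide (z ∈ l)) t with hu
    have hp := Phi_word_perm (fun z => decide (z ∈ l)) t
    have hxv := (mem_valleys_word hi x).1 (hv x (by simp))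
    obtain ⟨A, B, hs⟩ := exists_sub (t := u) (hp.mem_iff.2 hxv.mem_word)
    refine transform_word (Phi_incr _ hi hn ha) (hp.nodup_iff.2 hn) hs ?_
    refine Movable.of_sub_Phi hn ha (by simpa using hxl) hxv ?_ A B hs
    intro A' m C D hs'
    by_contra hc
    have hm : m ∈ l := by simpa using hc
    obtain ⟨l1, l2, rfl⟩ := List.append_of_mem hm
    -- If the node whose right child is `x` had been treated already, it would precede `x` in the
    -- list, which admissibility forbids.
    exact had A' m C x D hs' l1 (l2 ++ [x]) (by simp) (by simp)

end ITree

/-! ### The statistics on words -/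

/-- The number of consecutive pairs `(q, r)` in the word `p w` with `q < a < r`. -/
def crossFrom (a : ℕ) : ℕ → List ℕ → ℕ
  | _, [] => 0
  | p, q :: w => (if p < a ∧ a < q then 1 else 0) + crossFrom a q w

/-- The statistic `res`, by recursion on the word. -/
def resRec : List ℕ → ℕ
  | [] => 0
  | a :: w => crossFrom a a w + resRec w

/-- The index `j = w.length` reads the default value `0` past the end and contributes nothing. -/
theorem sum_cross (a : ℕ) : ∀ (w : List ℕ) (p : ℕ),
    (∑ j ∈ Finset.range (w.length + 1),
      if (p :: w).getD (j + 1) 0 > a ∧ a > (p :: w).getD j 0 then 1 else 0) = crossFrom a p w := by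
  intro w
  induction w with
  | nil => intro p; simp [crossFrom]
  | cons q w ih =>
    intro p
    rw [List.length_cons, Finset.sum_range_succ', crossFrom, ← ih q, add_comm]
    simp only [List.getD_cons_succ, List.getD_cons_zero, and_comm, gt_iff_lt]

theorem sum_eq_resRec (σ : List ℕ) :
    (∑ i ∈ Finset.range σ.length, ∑ j ∈ Finset.range σ.length,
      if i < j ∧ σ.getD (j + 1) 0 > σ.getD i 0 ∧ σ.getD i 0 > σ.getD j 0 then 1 else 0) =
      resRec σ := by
  induction σ with
  | nil => simp [resRec]
  | cons a w ih =>
    rw [resRec, ← ih, ← sum_cross, List.length_cons, Finset.sum_range_succ', add_comm]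
    congr 1
    · refine Finset.sum_congr rfl fun j _ => ?_
      -- The term `j = 0` vanishes on both sides: a letter is neither before nor below itself. This
      -- is why `resRec` starts `crossFrom a` at `a`.
      cases j with
      | zero => simp
      | succ j => simp
    · refine Finset.sum_congr rfl fun i _ => ?_
      rw [Finset.sum_range_succ']
      simp

theorem res_eq_resRec (σ : List ℕ) : res σ = resRec σ := by
  rw [← sum_eq_resRec, ← Finset.sum_product', ← Finset.card_filter]
  unfold res entry
  refine Finset.card_bij' (fun p _ => (p.1 - 1, p.2 - 1)) (fun p _ => (p.1 + 1, p.2 + 1)) ?_ ?_ ?_ ?_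
  · rintro ⟨i, j⟩ h
    simp only [Finset.mem_filter, Finset.mem_product, Finset.mem_Icc, Finset.mem_range] at h ⊢
    obtain ⟨⟨hi, hj⟩, h1, h2, h3, h4⟩ := h
    obtain ⟨i, rfl⟩ : ∃ k, i = k + 1 := ⟨i - 1, by omega⟩
    obtain ⟨j, rfl⟩ : ∃ k, j = k + 1 := ⟨j - 1, by omega⟩
    simp only [List.getD_cons_succ, Nat.add_sub_cancel] at h3 h4 ⊢
    exact ⟨⟨by omega, by omega⟩, by omega, h3, h4⟩
  · rintro ⟨i, j⟩ h
    simp only [Finset.mem_filter, Finset.mem_product, Finset.mem_Icc, Finset.mem_range] at h ⊢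
    obtain ⟨⟨hi, hj⟩, h1, h3, h4⟩ := h
    simp only [List.getD_cons_succ]
    refine ⟨⟨by omega, by omega⟩, by omega, ?_, h3, h4⟩
    -- If `j + 1` were past the end, the default entry `0` could not exceed `σᵢ`.
    by_contra hc
    rw [List.getD_eq_default _ _ (by omega : σ.length ≤ j + 1)] at h3
    exact absurd h3 (Nat.not_lt_zero _)
  · rintro ⟨i, j⟩ h
    simp only [Finset.mem_filter, Finset.mem_product, Finset.mem_Icc] at h
    simp only [Prod.mk.injEq]; omega
  · rintro ⟨i, j⟩ h
    simp

theorem entry_reverse (σ : List ℕ) (i : ℕ) (h1 : 1 ≤ i) (h2 : i ≤ σ.length) :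
    entry σ.reverse i = entry σ (σ.length + 1 - i) := by
  obtain ⟨i, rfl⟩ : ∃ k, i = k + 1 := ⟨i - 1, by omega⟩
  obtain ⟨j, hj⟩ : ∃ k, σ.length + 1 - (i + 1) = k + 1 := ⟨σ.length - (i + 1), by omega⟩
  unfold entry
  rw [hj, List.getD_cons_succ, List.getD_cons_succ, List.getD_reverse _ (by omega)]
  congr 1; omega

/-- Reflecting positions turns the descent at `(i - 1, i)` into an ascent and puts the middle letter
`σⱼ` in front of it. -/
theorem les_eq_res_reverse (σ : List ℕ) : les σ = res σ.reverse := by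
  unfold les res
  rw [List.length_reverse]
  refine Finset.card_bij' (fun p _ => (σ.length + 1 - p.2, σ.length + 1 - p.1))
    (fun p _ => (σ.length + 1 - p.2, σ.length + 1 - p.1)) ?_ ?_ ?_ ?_
  · rintro ⟨i, j⟩ h
    simp only [Finset.mem_filter, Finset.mem_product, Finset.mem_Icc] at h ⊢
    obtain ⟨⟨hi, hj⟩, h1, h2, h3, h4⟩ := h
    rw [entry_reverse _ _ (by omega) (by omega), entry_reverse _ _ (by omega) (by omega),
      entry_reverse _ _ (by omega) (by omega)]
    rw [show σ.length + 1 - (σ.length + 1 - i + 1) = i - 1 by omega,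
      show σ.length + 1 - (σ.length + 1 - j) = j by omega,
      show σ.length + 1 - (σ.length + 1 - i) = i by omega]
    exact ⟨⟨by omega, by omega⟩, by omega, by omega, h3, h4⟩
  · rintro ⟨i, j⟩ h
    simp only [Finset.mem_filter, Finset.mem_product, Finset.mem_Icc] at h ⊢
    obtain ⟨⟨hi, hj⟩, h1, h2, h3, h4⟩ := h
    rw [entry_reverse _ _ (by omega) (by omega), entry_reverse _ _ (by omega) (by omega)] at h3
    rw [entry_reverse _ _ (by omega) (by omega), entry_reverse _ _ (by omega) (by omega)] at h4
    rw [show σ.length + 1 - j - 1 = σ.length + 1 - (j + 1) by omega]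
    exact ⟨⟨by omega, by omega⟩, by omega, by omega, h3, h4⟩
  · rintro ⟨i, j⟩ h
    simp only [Finset.mem_filter, Finset.mem_product, Finset.mem_Icc] at h
    simp only [Prod.mk.injEq]; omega
  · rintro ⟨i, j⟩ h
    simp only [Finset.mem_filter, Finset.mem_product, Finset.mem_Icc] at h
    simp only [Prod.mk.injEq]; omega

theorem crossFrom_append (a m : ℕ) (v : List ℕ) : ∀ (u : List ℕ) (p : ℕ),
    crossFrom a p (u ++ m :: v) =
      crossFrom a p u + (if u.getLastD p < a ∧ a < m then 1 else 0) + crossFrom a m v := by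
  intro u
  induction u with
  | nil => intro p; simp [crossFrom]
  | cons q u ih => intro p; simp only [List.cons_append, crossFrom, ih, List.getLastD_cons]; omega

theorem crossFrom_of_forall_lt {a : ℕ} : ∀ {w : List ℕ} {p : ℕ}, (∀ c ∈ w, a < c) →
    crossFrom a p w = if p < a ∧ w ≠ [] then 1 else 0 := by
  intro w
  induction w with
  | nil => intro p _; simp [crossFrom]
  | cons q w ih =>
    intro p h
    have hq : a < q := h q (by simp)
    rw [crossFrom, ih fun c hc => h c (by simp [hc]), if_neg (by omega : ¬ (q < a ∧ w ≠ []))]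
    simp [hq]

/-- For a letter `a` of `u`, stepping to `m < a` is never an upward crossing of `a`. The crossings
counted by `a` thus lie either inside `u` or in `v` started at `m`. -/
theorem resRec_append {m : ℕ} (v : List ℕ) : ∀ {u : List ℕ}, (∀ a ∈ u, m < a) →
    resRec (u ++ m :: v) = resRec u + (u.map fun a => crossFrom a m v).sum + resRec (m :: v) := by
  intro u
  induction u with
  | nil => intro _; simp [resRec]
  | cons a u ih =>
    intro h
    have ha : m < a := h a (by simp)
    rw [List.cons_append, resRec, ih fun c hc => h c (by simp [hc]), crossFrom_append,
      if_neg (by omega), List.map_cons, List.sum_cons]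
    simp only [resRec]
    omega

/-! ### The statistics as sums over the nodes of a tree -/

namespace ITree

/-- The number of maximal factors of the word of `t` all of whose letters exceed `a`. -/
def blocks (a : ℕ) : ITree → ℕ
  | nil => 0
  | node L m R => if a < m then 1 else L.blocks a + R.blocks a

/-- The sum over the letters `a` of `L` of the number of blocks of letters above `a` in `R`. -/
def pairs (L R : ITree) : ℕ := (L.word.map fun a => R.blocks a).sum

def resTree : ITree → ℕ
  | nil => 0
  | node L _ R => L.resTree + R.resTree + pairs L R

def lesTree : ITree → ℕ
  | nil => 0
  | node L _ R => L.lesTree + R.lesTree + pairs R L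

def mirror : ITree → ITree
  | nil => nil
  | node L m R => node R.mirror m L.mirror

/-- Starting below `a`, each upward crossing of the level `a` opens one maximal block above `a`. If
the root exceeds `a`, the whole word is one block; otherwise the root separates the blocks of the
two sides. -/
theorem crossFrom_word {t : ITree} {a : ℕ} : ∀ {b p : ℕ}, t.Incr b → a ∉ t.word → p ≤ b → p < a →
    crossFrom a p t.word = t.blocks a := by
  induction t with
  | nil => intros; simp [word, crossFrom, blocks]
  | node L m R ihL ihR =>
    intro b p h ha hp hpa
    have hw : ∀ c ∈ (node L m R).word, m ≤ c := by
      intro c hc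
      simp only [word, List.mem_append, List.mem_cons] at hc
      rcases hc with hc | rfl | hc
      exacts [(h.2.1.lt c hc).le, le_rfl, (h.2.2.lt c hc).le]
    rw [blocks]
    split_ifs with ham
    · rw [crossFrom_of_forall_lt fun c hc => ham.trans_le (hw c hc), if_pos ⟨hpa, by simp⟩]
    · simp only [word, List.mem_append, List.mem_cons, not_or] at ha
      have hma : m < a := by omega
      rw [word, crossFrom_append, ihL h.2.1 ha.1 (hp.trans h.1.le) hpa, ihR h.2.2 ha.2.2 le_rfl hma,
        if_neg (by omega), add_zero]

/-- The root contributes nothing as a middle letter, since all that follows exceeds it. A letter of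
`L` meets its crossings within `L` or, after the root, at the blocks of `R`. -/
theorem resRec_word {t : ITree} : ∀ {b : ℕ}, t.Incr b → t.word.Nodup →
    resRec t.word = t.resTree := by
  induction t with
  | nil => intros; simp [word, resRec, resTree]
  | node L m R ihL ihR =>
    intro b h hn
    obtain ⟨nL, nR, h1, h2, h3⟩ := nodup_node hn
    rw [word, resRec_append _ h.2.1.lt, ihL h.2.1 nL, resRec, ihR h.2.2 nR,
      crossFrom_of_forall_lt h.2.2.lt, if_neg (by simp), resTree, pairs, zero_add]
    have : (L.word.map fun a => crossFrom a m R.word) = L.word.map fun a => R.blocks a :=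
      List.map_congr_left fun a ha => crossFrom_word h.2.2 (h3 a ha) le_rfl (h.2.1.lt a ha)
    rw [this]; omega

theorem word_mirror (t : ITree) : t.mirror.word = t.word.reverse := by
  induction t with
  | nil => rfl
  | node L m R ihL ihR => simp [mirror, word, ihL, ihR]

theorem Incr.mirror {t : ITree} : ∀ {b : ℕ}, t.Incr b → t.mirror.Incr b := by
  induction t with
  | nil => intros; trivial
  | node L m R ihL ihR => intro b h; exact ⟨h.1, ihR h.2.2, ihL h.2.1⟩

theorem blocks_mirror (a : ℕ) (t : ITree) : t.mirror.blocks a = t.blocks a := by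
  induction t with
  | nil => rfl
  | node L m R ihL ihR => rw [ITree.mirror, blocks, blocks, ihL, ihR, add_comm]

theorem pairs_congr {L L' R R' : ITree} (hL : L.word.Perm L'.word)
    (hR : ∀ a ∈ L.word, R.blocks a = R'.blocks a) : pairs L R = pairs L' R' := by
  rw [pairs, pairs, List.map_congr_left hR]
  exact (hL.map _).sum_eq

theorem resTree_mirror (t : ITree) : t.mirror.resTree = t.lesTree := by
  induction t with
  | nil => rfl
  | node L m R ihL ihR =>
    rw [ITree.mirror, resTree, lesTree, ihL, ihR, add_comm L.lesTree]
    congr 1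
    exact pairs_congr (by rw [word_mirror]; exact List.reverse_perm _)
      fun a _ => blocks_mirror a L

theorem res_word {t : ITree} {b : ℕ} (h : t.Incr b) (hn : t.word.Nodup) :
    res t.word = t.resTree := by
  rw [res_eq_resRec, resRec_word h hn]

theorem les_word {t : ITree} {b : ℕ} (h : t.Incr b) (hn : t.word.Nodup) :
    les t.word = t.lesTree := by
  rw [les_eq_res_reverse, ← word_mirror, res_word h.mirror, resTree_mirror]
  rw [word_mirror]; simpa using hn

theorem blocks_of_lt {t : ITree} {a : ℕ} (ht : t ≠ nil) (h : a < t.root) : t.blocks a = 1 := by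
  cases t with
  | nil => exact absurd rfl ht
  | node L m R => rw [blocks, if_pos (by simpa [root] using h)]

theorem pairs_nil_right (L : ITree) : pairs L nil = 0 := by
  rw [pairs, List.sum_eq_zero]
  simp [blocks]

theorem pairs_nil_left (L : ITree) : pairs nil L = 0 := by simp [pairs, word]

theorem pairs_node_left (A : ITree) (y : ℕ) (B L : ITree) :
    pairs (node A y B) L = pairs A L + (L.blocks y + pairs B L) := by
  simp [pairs, word]

theorem pairs_node_right {L A : ITree} {y : ℕ} {B : ITree} (h : ∀ a ∈ L.word, y < a) :
    pairs L (node A y B) = pairs L A + pairs L B := by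
  unfold pairs
  rw [← List.sum_map_add]
  refine congrArg List.sum (List.map_congr_left fun a ha => ?_)
  rw [blocks, if_neg (h a ha).not_gt]

theorem lt_of_root_lt {L R : ITree} {y b : ℕ} {A B : ITree} (hL : L.Incr b)
    (hR : R = node A y B) (h : R.root < L.root) : ∀ a ∈ L.word, y < a := by
  subst hR
  exact (hL.of_lt h).lt

/-- Every letter of `L` exceeds `y`, so `pairs L R` splits over the children of `y` and the old
pairs are only redistributed. The extra pair is `y` with the nonempty tree now to the right of `m`,
which lies wholly above `y` and is a single block. -/
theorem rot_resTree {L : ITree} {m : ℕ} {R : ITree} {b : ℕ} (h : (node L m R).Incr b)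
    (hm : Movable L R) : (rot L m R).resTree = (node L m R).resTree + 1 := by
  refine rot_cases (motive := fun L m R t => (node L m R).Incr b → Movable L R →
    t.resTree = (node L m R).resTree + 1) ?_ ?_ ?_ ?_ ?_ L m R h hm
  · intro m R _ h; exact absurd rfl h.1
  · intro L m _ h; exact absurd h.2.1 (by simp [root])
  · intro L m y hL h hm
    have hy := lt_of_root_lt h.2.1 rfl hm.2.1
    simp only [resTree, pairs_node_left, pairs_nil_left, pairs_node_right hy, pairs_nil_right,
      blocks_of_lt hL hm.2.1]
    omega
  · intro L m y B hL hB h hm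
    have hy := lt_of_root_lt h.2.1 rfl hm.2.1
    simp only [resTree, pairs_node_left, pairs_nil_left, pairs_node_right hy, pairs_nil_right,
      blocks_of_lt hB h.2.2.2.2.root_gt]
    omega
  · intro L m A y B hL hA h hm
    have hy := lt_of_root_lt h.2.1 rfl hm.2.1
    have hB : B ≠ nil := fun hB => hA (isNil_iff.1 (hm.2.2.2.2 (isNil_iff.2 hB)))
    simp only [resTree, pairs_node_left, pairs_node_right hy, blocks_of_lt hB h.2.2.2.2.root_gt]
    omega

/-- Before the transform `y` sees `L`, a single block above it, across `m`. That pair is lost and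
the others are redistributed. -/
theorem rot_lesTree {L : ITree} {m : ℕ} {R : ITree} {b : ℕ} (h : (node L m R).Incr b)
    (hm : Movable L R) : (rot L m R).lesTree + 1 = (node L m R).lesTree := by
  refine rot_cases (motive := fun L m R t => (node L m R).Incr b → Movable L R →
    t.lesTree + 1 = (node L m R).lesTree) ?_ ?_ ?_ ?_ ?_ L m R h hm
  · intro m R _ h; exact absurd rfl h.1
  · intro L m _ h; exact absurd h.2.1 (by simp [root])
  · intro L m y hL h hm
    have hy := lt_of_root_lt h.2.1 rfl hm.2.1
    simp only [lesTree, pairs_node_left, pairs_nil_left, pairs_node_right hy, pairs_nil_right,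
      blocks_of_lt hL hm.2.1]
    omega
  · intro L m y B hL hB h hm
    simp only [lesTree, pairs_node_left, pairs_nil_left, pairs_node_right h.2.2.2.2.lt,
      pairs_nil_right, blocks_of_lt hL hm.2.1]
    omega
  · intro L m A y B hL hA h hm
    simp only [lesTree, pairs_node_left, pairs_node_right h.2.2.2.2.lt, blocks_of_lt hL hm.2.1]
    omega

/-- For `m ≤ a < y` both subtrees of `m` lie above `a`, before and after, which gives two blocks
each time. For `a ≥ y` the same pieces are added up in another order. -/
theorem rot_blocks {L : ITree} {m : ℕ} {R : ITree} {b a : ℕ} (h : (node L m R).Incr b)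
    (hm : Movable L R) : (rot L m R).blocks a = (node L m R).blocks a := by
  by_cases ham : a < m
  · have e : ∀ t : ITree, t.root = m → t.blocks a = 1 := by
      intro t ht
      refine blocks_of_lt ?_ (by simpa [ht] using ham)
      rintro rfl; simp [root] at ht
    rw [e _ (rot_root L m R), e _ rfl]
  refine rot_cases (motive := fun L m R t => ¬ a < m → (node L m R).Incr b → Movable L R →
    t.blocks a = (node L m R).blocks a) ?_ ?_ ?_ ?_ ?_ L m R ham h hm
  · intros; rfl
  · intros; rfl
  · intro L m y hL ham h hm
    simp only [blocks, ham, if_false]; omega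
  · intro L m y B hL hB ham h hm
    simp only [blocks, ham, if_false]
    split_ifs with hay
    · have h1 := hm.2.1
      have h2 : (a : WithTop ℕ) < y := by simpa using hay
      rw [blocks_of_lt hL (h2.trans h1), blocks_of_lt hB (h2.trans h.2.2.2.2.root_gt)]
    · omega
  · intro L m A y B hL hA ham h hm
    have hB : B ≠ nil := fun hB => hA (isNil_iff.1 (hm.2.2.2.2 (isNil_iff.2 hB)))
    simp only [blocks, ham, if_false]
    split_ifs with hay
    · have h1 := hm.2.1
      have h2 : (a : WithTop ℕ) < y := by simpa using hay
      rw [blocks_of_lt hL (h2.trans h1), blocks_of_lt hB (h2.trans h.2.2.2.2.root_gt)]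
    · omega

theorem Andre.movable_Phi {L R : ITree} {m : ℕ} (S : ℕ → Bool) (h : (node L m R).Andre)
    (hn : (node L m R).word.Nodup) (hL : L ≠ nil) : Movable (Phi S L) (Phi S R) :=
  ⟨by simpa using hL, by simpa using (h.root_lt hn).resolve_right hL,
    Phi_noLeftOnly S h.2.1.noLeftOnly⟩

/-- Transforms inside a subtree do not change its contribution to the pairs counted at an ancestor.
-/
theorem Phi_blocks (S : ℕ → Bool) {a : ℕ} {t : ITree} : ∀ {b : ℕ}, t.Incr b → t.word.Nodup →
    t.Andre → (Phi S t).blocks a = t.blocks a := by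
  induction t with
  | nil => intros; rfl
  | node L m R ihL ihR =>
    intro b h hn ha
    obtain ⟨nL, nR, -⟩ := nodup_node hn
    have e : (node (Phi S L) m (Phi S R)).blocks a = (node L m R).blocks a := by
      rw [blocks, blocks, ihL h.2.1 nL ha.1, ihR h.2.2 nR ha.2.1]
    rcases Phi_node_cases S L m R with ⟨e', -⟩ | ⟨e', hL, -⟩
    · rw [e', e]
    · rw [e', rot_blocks ⟨h.1, Phi_incr S h.2.1 nL ha.1, Phi_incr S h.2.2 nR ha.2.1⟩
        (ha.movable_Phi S hn hL), e]

theorem pairs_Phi (S : ℕ → Bool) {L R : ITree} {b : ℕ} (h : R.Incr b) (hn : R.word.Nodup)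
    (ha : R.Andre) : pairs (Phi S L) (Phi S R) = pairs L R :=
  pairs_congr (Phi_word_perm S L) fun _ _ => Phi_blocks S h hn ha

theorem numBinary_node_of_false {S : ℕ → Bool} {L R : ITree} {m : ℕ}
    (h : L ≠ nil → S m = false) :
    (node L m R).numBinary S = L.numBinary S + R.numBinary S := by
  rw [numBinary, if_neg, add_zero]
  rintro ⟨h1, h2, -⟩
  have : L ≠ nil := by rintro rfl; simp at h2
  simp [h this] at h1

theorem numBinary_node_of_true {S : ℕ → Bool} {L R : ITree} {m : ℕ} (hN : (node L m R).NoLeftOnly)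
    (hL : L ≠ nil) (h : S m = true) :
    (node L m R).numBinary S = L.numBinary S + R.numBinary S + 1 := by
  have hL' : L.isNil = false := by simpa using mt isNil_iff.1 hL
  rw [numBinary, if_pos]
  refine ⟨h, hL', ?_⟩
  by_contra hc
  simp [hN.2.2 (by simpa using hc)] at hL'

theorem Phi_resTree (S : ℕ → Bool) {t : ITree} : ∀ {b : ℕ}, t.Incr b → t.word.Nodup → t.Andre →
    (Phi S t).resTree = t.resTree + t.numBinary S := by
  induction t with
  | nil => intros; rfl
  | node L m R ihL ihR =>
    intro b h hn ha
    obtain ⟨nL, nR, -⟩ := nodup_node hn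
    have e : (node (Phi S L) m (Phi S R)).resTree =
        (node L m R).resTree + (L.numBinary S + R.numBinary S) := by
      rw [resTree, resTree, ihL h.2.1 nL ha.1, ihR h.2.2 nR ha.2.1, pairs_Phi S h.2.2 nR ha.2.1]
      omega
    rcases Phi_node_cases S L m R with ⟨e', hS⟩ | ⟨e', hL, hS⟩
    · rw [e', e, numBinary_node_of_false hS]
    · rw [e', rot_resTree ⟨h.1, Phi_incr S h.2.1 nL ha.1, Phi_incr S h.2.2 nR ha.2.1⟩
        (ha.movable_Phi S hn hL), e, numBinary_node_of_true ha.noLeftOnly hL hS]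
      omega

theorem Phi_lesTree (S : ℕ → Bool) {t : ITree} : ∀ {b : ℕ}, t.Incr b → t.word.Nodup → t.Andre →
    (Phi S t).lesTree + t.numBinary S = t.lesTree := by
  induction t with
  | nil => intros; rfl
  | node L m R ihL ihR =>
    intro b h hn ha
    obtain ⟨nL, nR, -⟩ := nodup_node hn
    have e : (node (Phi S L) m (Phi S R)).lesTree + (L.numBinary S + R.numBinary S) =
        (node L m R).lesTree := by
      rw [lesTree, lesTree, ← ihL h.2.1 nL ha.1, ← ihR h.2.2 nR ha.2.1,
        pairs_Phi S h.2.1 nL ha.1]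
      omega
    rcases Phi_node_cases S L m R with ⟨e', hS⟩ | ⟨e', hL, hS⟩
    · rw [e', numBinary_node_of_false hS, e]
    · have := rot_lesTree ⟨h.1, Phi_incr S h.2.1 nL ha.1, Phi_incr S h.2.2 nR ha.2.1⟩
        (ha.movable_Phi S hn hL)
      rw [e', numBinary_node_of_true ha.noLeftOnly hL hS]
      omega

/-! ### Types of valleys and the map `phi` on words -/

theorem Sub.nodup {s t : ITree} (h : Sub s t) (hn : t.word.Nodup) : s.word.Nodup := by
  induction t with
  | nil => exact h.elim
  | node L m R ihL ihR =>
    obtain ⟨nL, nR, -⟩ := nodup_node hn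
    rcases h with h | h | h
    · rw [h]; exact hn
    · exact ihL h nL
    · exact ihR h nR

/-- At a valley of an André permutation, `min y₁ y₂` is the root of the right subtree. -/
theorem Andre.min_y1_y2 {t A C D : ITree} {x y : ℕ} (hi : t.Incr 0) (hn : t.word.Nodup)
    (ha : t.Andre) (h : Sub (node A x (node C y D)) t) (hx : x ∈ valleys t.word) :
    min (y1 t.word x) (y2 t.word x) = y := by
  have hA : A ≠ nil := by
    rintro rfl
    have := (cls_of_sub hn h).1 ((mem_valleys_word hi x).1 hx)
    simp at this
  exact (min_y1_y2_word hi hn h hA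
    (((ha.sub h).root_lt (h.nodup hn)).resolve_right hA)).1

theorem Sub.exists_right {t A B : ITree} {x : ℕ} (hi : t.Incr 0) (hn : t.word.Nodup)
    (h : Sub (node A x B) t) (hx : x ∈ valleys t.word) : ∃ C y D, B = node C y D := by
  have := (cls_of_sub hn h).1 ((mem_valleys_word hi x).1 hx)
  cases B with
  | nil => simp at this
  | node C y D => exact ⟨C, y, D, rfl⟩

/-- Every valley of an André permutation is either of type I or of type II. -/
theorem Andre.isTypeI_iff {t : ITree} {x : ℕ} (hi : t.Incr 0) (hn : t.word.Nodup)
    (ha : t.Andre) (hx : x ∈ valleys t.word) : IsTypeI t.word x ↔ ¬ IsTypeII t.word x := by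
  obtain ⟨A, B, hs⟩ := exists_sub ((mem_valleys_word hi x).1 hx).mem_word
  obtain ⟨C, y, D, rfl⟩ := Sub.exists_right hi hn hs hx
  have hN := (noLeftOnly_iff.1 ha.noLeftOnly) y
  rw [cls_of_sub hn hs.right] at hN
  rw [IsTypeI, IsTypeII, ha.min_y1_y2 hi hn hs hx, mem_peaks_word hi, mem_doubleAscents_word hi,
    mem_valleys_word hi, cls_of_sub hn hs.right, cls_of_sub hn hs.right, cls_of_sub hn hs.right]
  revert hN
  cases C.isNil <;> cases D.isNil <;> simp

/-- The transforms at the valleys in `S`, those of type I first and in any order, amount to the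
recursive transform of the tree. -/
theorem transformList_transformList_word {t : ITree} (hi : t.Incr 0) (hn : t.word.Nodup)
    (ha : t.Andre) {S : Finset ℕ} (hS : S ⊆ valleys t.word) {l : List ℕ} (hl : l.Nodup)
    (hlS : l.toFinset = partI t.word S) :
    transformList (transformList t.word l) ((partII t.word S).sort (· ≥ ·)) =
      (Phi (fun x => decide (x ∈ S)) t).word := by
  set l' := (partII t.word S).sort (· ≥ ·) with hl'
  have mI : ∀ x, x ∈ l ↔ x ∈ S ∧ IsTypeI t.word x := by
    intro x
    rw [← List.mem_toFinset, hlS, partI, Finset.mem_filter]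
  have mII : ∀ x, x ∈ l' ↔ x ∈ S ∧ IsTypeII t.word x := by
    intro x
    rw [hl', Finset.mem_sort, partII, Finset.mem_filter]
  have m : ∀ x, x ∈ l ++ l' ↔ x ∈ S := by
    intro x
    rw [List.mem_append, mI, mII]
    constructor
    · rintro (h | h) <;> exact h.1
    · intro h
      by_cases hx : IsTypeII t.word x
      · exact Or.inr ⟨h, hx⟩
      · exact Or.inl ⟨h, (ha.isTypeI_iff hi hn (hS h)).2 hx⟩
  have nd : (l ++ l').Nodup := by
    rw [List.nodup_append]
    refine ⟨hl, Finset.sort_nodup _ _, ?_⟩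
    rintro x hx y hy rfl
    rw [mI] at hx
    rw [mII] at hy
    exact (ha.isTypeI_iff hi hn (hS hx.1)).1 hx.2 hy.2
  have sorted : l'.Pairwise (· ≥ ·) := Finset.pairwise_sort _ _
  -- If `x` and its right root `y` both lie in `S`, then `y` is a valley, so `x` is of type II and
  -- stands in the decreasing list `l'`. As `y > x`, the letter `y` cannot come after it.
  have had : Admissible (l ++ l') t := by
    intro A x C y D hs l1 l2 e hy
    have hx : x ∈ S := (m x).1 (by rw [e]; simp)
    have hyS : y ∈ S := (m y).1 (by rw [e]; simp [hy])
    have hxII : IsTypeII t.word x := by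
      rw [IsTypeII, ha.min_y1_y2 hi hn hs (hS hx)]
      exact hS hyS
    have hxl : x ∉ l := fun h => (ha.isTypeI_iff hi hn (hS hx)).1 ((mI x).1 h).2 hxII
    have hlt : x < y := by
      obtain ⟨h, -⟩ := hs.exists_factor hi hn le_rfl le_rfl
      exact h.2.2.1
    obtain ⟨as, h1, h2⟩ | ⟨as, h1, h2⟩ := List.append_eq_append_iff.1 e
    · rw [h2] at sorted
      have := (List.pairwise_append.1 sorted).2.1
      exact absurd ((List.pairwise_cons.1 this).1 y hy) (by simpa using hlt)
    · cases as with
      | nil =>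
        simp only [List.nil_append] at h2
        rw [← h2] at sorted
        exact absurd ((List.pairwise_cons.1 sorted).1 y hy) (by simpa using hlt)
      | cons c as =>
        simp only [List.cons_append, List.cons.injEq] at h2
        exact hxl (by rw [h1, h2.1]; simp)
  have := transformList_word hi hn ha nd (fun x hx => hS ((m x).1 hx)) had
  simp only [m] at this
  rw [← this]
  simp [transformList, List.foldl_append]

/-- Selecting a node without left child has no effect, and without left-only nodes the remaining
ones have two children. -/
theorem Phi_congr_of_cls {S S' : ℕ → Bool} {t : ITree} (hN : t.NoLeftOnly)
    (h : ∀ x, Cls (fun l r => l = false ∧ r = false) t x → S x = S' x) : Phi S t = Phi S' t := by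
  induction t with
  | nil => rfl
  | node L m R ihL ihR =>
    have eL := ihL hN.1 fun x hx => h x (Or.inr (Or.inl hx))
    have eR := ihR hN.2.1 fun x hx => h x (Or.inr (Or.inr hx))
    by_cases hL : L = nil
    · subst hL
      simp [Phi, eR]
    · have hL' : L.isNil = false := by simpa using mt isNil_iff.1 hL
      have hR' : R.isNil = false := by
        by_contra hc
        simp [hN.2.2 (by simpa using hc)] at hL'
      rw [Phi, Phi, eL, eR, h m (Or.inl ⟨rfl, hL', hR'⟩)]

theorem phi_word {t : ITree} (hi : t.Incr 0) (hn : t.word.Nodup) (ha : t.Andre) {S : Finset ℕ}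
    (hS : S ⊆ valleys t.word) : phi t.word S = (Phi (fun x => decide (x ∈ S)) t).word :=
  transformList_transformList_word hi hn ha hS (Finset.sort_nodup _ _)
    (Finset.sort_toFinset _ _)

end ITree

/-! ### The bijection and the indexing of valleys by rank -/

open ITree

theorem IsPermutation.nodup {n : ℕ} {σ : List ℕ} (h : IsPermutation n σ) : σ.Nodup :=
  (List.Perm.nodup_iff h).2 List.nodup_range'

theorem IsPermutation.exists_tree {n : ℕ} {σ : List ℕ} (h : IsPermutation n σ) :
    ∃ t : ITree, t.Incr 0 ∧ t.word = σ :=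
  exists_word_eq σ 0 (fun a ha => by
    have := (List.Perm.mem_iff h).1 ha
    simp [List.mem_range'] at this
    omega) h.nodup

theorem mem_D_iff {n k : ℕ} {t : ITree} (hi : t.Incr 0) :
    t.word ∈ D n k ↔ IsPermutation n t.word ∧ t.Andre ∧ (valleys t.word).card = k := by
  rw [D, Set.mem_ofPred_eq, isAndre_word_iff hi, and_assoc]
  refine and_congr_right fun hp => and_congr_right fun ha => ?_
  rw [des_word ha.noLeftOnly hi hp.nodup]

theorem mem_G_iff {n k : ℕ} {t : ITree} (hi : t.Incr 0) :
    t.word ∈ G n k ↔ IsPermutation n t.word ∧ (valleys t.word).card = k ∧ t.NoLeftOnly := by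
  rw [G, Set.mem_ofPred_eq, doubleDescents_word_eq_empty hi]

theorem exists_tree_of_mem_D {n k : ℕ} {σ : List ℕ} (h : σ ∈ D n k) :
    ∃ t : ITree, t.Incr 0 ∧ t.word = σ ∧ t.word.Nodup ∧ IsPermutation n t.word ∧ t.Andre ∧
      (valleys t.word).card = k := by
  obtain ⟨t, hi, rfl⟩ := h.1.1.exists_tree
  have := (mem_D_iff hi).1 h
  exact ⟨t, hi, rfl, this.1.nodup, this⟩

theorem valleys_word_Phi {t : ITree} (S : ℕ → Bool) (hi : t.Incr 0) (hn : t.word.Nodup)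
    (ha : t.Andre) : valleys (Phi S t).word = valleys t.word := by
  ext x
  rw [mem_valleys_word (Phi_incr S hi hn ha), mem_valleys_word hi, Phi_cls _ _ ha.noLeftOnly]

/-- The ranks of the elements of `V` within `V` are `1, …, #V`. -/
theorem image_rank (V : Finset ℕ) :
    V.image (fun a => (V.filter fun b => b ≤ a).card) = Finset.Icc 1 V.card ∧
      Set.InjOn (fun a => (V.filter fun b => b ≤ a).card) V := by
  have inj : Set.InjOn (fun a => (V.filter fun b => b ≤ a).card) V := by
    have mono : ∀ a ∈ V, ∀ c ∈ V, a < c →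
        (V.filter fun b => b ≤ a).card < (V.filter fun b => b ≤ c).card := by
      intro a _ c hc hac
      refine Finset.card_lt_card ⟨fun b hb => ?_, fun hsub => ?_⟩
      · simp only [Finset.mem_filter] at hb ⊢
        exact ⟨hb.1, hb.2.trans hac.le⟩
      · have := hsub (Finset.mem_filter.2 ⟨hc, le_rfl⟩)
        exact absurd (Finset.mem_filter.1 this).2 (not_le.2 hac)
    intro a ha c hc h
    rcases lt_trichotomy a c with hlt | heq | hlt
    · exact absurd h (mono a ha c hc hlt).ne
    · exact heq
    · exact absurd h (mono c hc a ha hlt).ne'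
  refine ⟨Finset.eq_of_subset_of_card_le ?_ ?_, inj⟩
  · intro i hi
    obtain ⟨a, ha, rfl⟩ := Finset.mem_image.1 hi
    rw [Finset.mem_Icc]
    exact ⟨Finset.card_pos.2 ⟨a, Finset.mem_filter.2 ⟨ha, le_rfl⟩⟩, Finset.card_filter_le _ _⟩
  · rw [Finset.card_image_of_injOn inj]; simp

theorem valleySubset_subset (σ : List ℕ) (S : Finset ℕ) : valleySubset σ S ⊆ valleys σ :=
  Finset.filter_subset _ _

theorem image_valleySubset {σ : List ℕ} {S : Finset ℕ}
    (hS : S ⊆ Finset.Icc 1 (valleys σ).card) :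
    (valleySubset σ S).image (fun a => ((valleys σ).filter fun b => b ≤ a).card) = S := by
  rw [← (image_rank (valleys σ)).1] at hS
  ext i
  simp only [valleySubset, Finset.mem_image, Finset.mem_filter]
  constructor
  · rintro ⟨a, ⟨-, h⟩, rfl⟩; exact h
  · intro hi
    obtain ⟨a, ha, rfl⟩ := Finset.mem_image.1 (hS hi)
    exact ⟨a, ⟨ha, hi⟩, rfl⟩

theorem card_valleySubset {σ : List ℕ} {S : Finset ℕ}
    (hS : S ⊆ Finset.Icc 1 (valleys σ).card) : (valleySubset σ S).card = S.card := by
  conv_rhs => rw [← image_valleySubset hS]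
  refine (Finset.card_image_of_injOn ?_).symm
  exact (image_rank (valleys σ)).2.mono (by exact_mod_cast valleySubset_subset σ S)

theorem exists_valleySubset_eq {σ : List ℕ} {T : Finset ℕ} (hT : T ⊆ valleys σ) :
    ∃ S ⊆ Finset.Icc 1 (valleys σ).card, valleySubset σ S = T := by
  obtain ⟨h1, h2⟩ := image_rank (valleys σ)
  refine ⟨T.image fun a => ((valleys σ).filter fun b => b ≤ a).card, ?_, ?_⟩
  · rw [← h1]; exact Finset.image_subset_image hT
  · ext a
    simp only [valleySubset, Finset.mem_filter, Finset.mem_image]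
    constructor
    · rintro ⟨ha, c, hc, hac⟩
      rwa [← h2 (hT hc) ha hac]
    · intro ha
      exact ⟨hT ha, a, ha, rfl⟩

theorem numBinary_mem {t : ITree} (hi : t.Incr 0) (hn : t.word.Nodup) {T : Finset ℕ}
    (hT : T ⊆ valleys t.word) : t.numBinary (fun x => decide (x ∈ T)) = T.card := by
  rw [← card_filter_valleys_word _ hi hn]
  congr 1
  ext x
  simp only [Finset.mem_filter, decide_eq_true_eq]
  exact ⟨fun h => h.2, fun h => ⟨hT h, h⟩⟩

theorem phi_bijOn (n k : ℕ) :
    Set.BijOn (fun p : List ℕ × Finset ℕ => phi p.1 (valleySubset p.1 p.2))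
      (D n k ×ˢ {S : Finset ℕ | S ⊆ Finset.Icc 1 k}) (G n k) := by
  refine ⟨?_, ?_, ?_⟩
  · rintro ⟨σ, S⟩ ⟨hσ, -⟩
    obtain ⟨t, hi, rfl, hn, hp, ha, hk⟩ := exists_tree_of_mem_D hσ
    simp only
    rw [phi_word hi hn ha (valleySubset_subset _ _), mem_G_iff (Phi_incr _ hi hn ha),
      valleys_word_Phi _ hi hn ha]
    exact ⟨(Phi_word_perm _ t).trans hp, hk, Phi_noLeftOnly _ ha.noLeftOnly⟩
  · rintro ⟨σ, S⟩ ⟨hσ, hS⟩ ⟨σ', S'⟩ ⟨hσ', hS'⟩ h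
    obtain ⟨t, hi, rfl, hn, hp, ha, rfl⟩ := exists_tree_of_mem_D hσ
    obtain ⟨t', hi', rfl, hn', hp', ha', hk'⟩ := exists_tree_of_mem_D hσ'
    simp only [Set.mem_ofPred_eq] at h hS hS'
    rw [phi_word hi hn ha (valleySubset_subset _ _),
      phi_word hi' hn' ha' (valleySubset_subset _ _)] at h
    have e := word_injective (Phi_incr _ hi hn ha) (Phi_incr _ hi' hn' ha') h
    obtain ⟨rfl, hSS⟩ := Phi_injective hi hi' hn hn' ha ha' e
    have : valleySubset t.word S = valleySubset t.word S' := by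
      ext x
      have key : ∀ {S : Finset ℕ}, x ∈ valleySubset t.word S → x ∈ valleys t.word :=
        fun h => valleySubset_subset _ _ h
      constructor
      · intro hx
        simpa [hx] using hSS x ((mem_valleys_word hi x).1 (key hx))
      · intro hx
        simpa [hx] using hSS x ((mem_valleys_word hi x).1 (key hx))
    rw [← image_valleySubset hS, this, image_valleySubset hS']
  · intro σ hσ
    obtain ⟨u, hu, rfl⟩ := hσ.1.exists_tree
    obtain ⟨hp, hk, hN⟩ := (mem_G_iff hu).1 hσ
    obtain ⟨t, T, hi, ha, rfl⟩ := exists_Phi_eq _ le_rfl hu hp.nodup hN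
    have hn : t.word.Nodup := (Phi_word_perm T t).nodup_iff.1 hp.nodup
    rw [valleys_word_Phi _ hi hn ha] at hk
    -- The selection `T` found for the tree may contain letters that are not valleys; discarding
    -- them does not change `Phi`.
    obtain ⟨S, hS, hST⟩ := exists_valleySubset_eq (σ := t.word)
      (Finset.filter_subset (fun x => T x = true) (valleys t.word))
    refine ⟨(t.word, S), ⟨(mem_D_iff hi).2 ⟨(Phi_word_perm T t).symm.trans hp, ha, hk⟩,
      hk ▸ hS⟩, ?_⟩
    simp only
    rw [phi_word hi hn ha (valleySubset_subset _ _), hST]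
    refine congrArg word (Phi_congr_of_cls ha.noLeftOnly fun x hx => ?_)
    have := (mem_valleys_word hi x).2 hx
    cases hTx : T x <;> simp [this, hTx]

end AndrePerm

theorem mainTheorem2 (n k : ℕ) :
    -- the order in which the valleys of type I are treated is irrelevant
    (∀ σ ∈ AndrePerm.D n k, ∀ S ⊆ AndrePerm.valleys σ,
      ∀ l : List ℕ, l.Nodup → l.toFinset = AndrePerm.partI σ S →
        AndrePerm.phi σ S = AndrePerm.transformList (AndrePerm.transformList σ l)
          ((AndrePerm.partII σ S).sort (· ≥ ·))) ∧
    Set.BijOn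
      (fun p : List ℕ × Finset ℕ => AndrePerm.phi p.1 (AndrePerm.valleySubset p.1 p.2))
      (AndrePerm.D n k ×ˢ {S : Finset ℕ | S ⊆ Finset.Icc 1 k})
      (AndrePerm.G n k) ∧
    (∀ σ ∈ AndrePerm.D n k, ∀ S : Finset ℕ, S ⊆ Finset.Icc 1 k →
      AndrePerm.res (AndrePerm.phi σ (AndrePerm.valleySubset σ S)) = AndrePerm.res σ + S.card ∧
      (AndrePerm.les (AndrePerm.phi σ (AndrePerm.valleySubset σ S)) : ℤ) =
        (AndrePerm.les σ : ℤ) - (S.card : ℤ)) := by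
  refine ⟨?_, AndrePerm.phi_bijOn n k, ?_⟩
  · intro σ hσ S hS l hl hlS
    obtain ⟨t, hi, rfl, hn, -, ha, -⟩ := AndrePerm.exists_tree_of_mem_D hσ
    rw [AndrePerm.ITree.phi_word hi hn ha hS,
      AndrePerm.ITree.transformList_transformList_word hi hn ha hS hl hlS]
  · intro σ hσ S hS
    obtain ⟨t, hi, rfl, hn, -, ha, rfl⟩ := AndrePerm.exists_tree_of_mem_D hσ
    have hsub := AndrePerm.valleySubset_subset t.word S
    set T := AndrePerm.valleySubset t.word S with hT
    have hcard := AndrePerm.numBinary_mem hi hn hsub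
    rw [hT, AndrePerm.card_valleySubset hS, ← hT] at hcard
    have hi' := AndrePerm.ITree.Phi_incr (fun x => decide (x ∈ T)) hi hn ha
    have hn' := (AndrePerm.ITree.Phi_word_perm (fun x => decide (x ∈ T)) t).nodup_iff.2 hn
    have h1 := AndrePerm.ITree.Phi_resTree (fun x => decide (x ∈ T)) hi hn ha
    have h2 := AndrePerm.ITree.Phi_lesTree (fun x => decide (x ∈ T)) hi hn ha
    rw [AndrePerm.ITree.phi_word hi hn ha hsub, AndrePerm.ITree.res_word hi' hn',
      AndrePerm.ITree.res_word hi hn, AndrePerm.ITree.les_word hi' hn',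
      AndrePerm.ITree.les_word hi hn]
    rw [hcard] at h1 h2
    exact ⟨h1, by omega⟩
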